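/- Conventions. Alphabets are finite. $\mathrm{REG}$ and $\mathrm{CFL}$ are the families of all regular and of all context-free languages. For a family $\mathcal C$, $\mathrm{co}\,\mathcal C$ is the family of the languages $\Sigma^*\setminus A$, for $A\subseteq\Sigma^*$ in $\mathcal C$, and $\mathcal C$ is closed under complement if $A\in\mathcal C$ implies $\Sigma^*\setminus A\in\mathcal C$. A (multi-valued partial) function is a map $f:\Sigma^*\to\mathcal P(\Gamma^*)$ for alphabets $\Sigma,\Gamma$; it is single-valued if $|f(x)|\le 1$ for all $x$, and total if $f(x)\ne\emptyset$ for all $x$. $\mathrm{CFLMV}$ is the class of all functions $f$ for which there is a one-way one-head nondeterministic pushdown automaton (finite state set, finite transition function, $\lambda$-moves allowed, input $x$ given between two endmarkers, disjoint sets of accepting and rejecting halting states) with a write-only output tape, all of whose computation paths reach a halting state within $O(n)$ steps on inputs of length $n$, such that, for every $x$, $f(x)$ is the set of the strings that it outputs along its accepting computation paths on $x$. $\mathrm{NFAMV}$ is defined in the same way with one-way one-head nondeterministic finite automata with a write-only output tape ($\lambda$-moves allowed), again under the condition that all computation paths reach a halting state within $O(n)$ steps. $\mathrm{CFLSV_t}$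 and $\mathrm{NFASV_t}$ consist of the single-valued total functions in $\mathrm{CFLMV}$ and in $\mathrm{NFAMV}$, respectively. For strings $x,y$, $\left[{x\atop y}\right]$ is the two-track string whose $i$-th symbol is the pair of the $i$-th symbols of $x$ and $y$; if the lengths differ, the shorter string is first padded at its end with a new symbol $\#$ to the length of the longer one. For a language family $\mathcal C$ and a function class $\mathcal F$, $\mathcal C/\!/\mathcal F$ is the family of all languages $\{x\mid \exists y\in h(x)\ \left[{x\atop y}\right]\in B\}$ with $B\in\mathcal C$ and $h\in\mathcal F$. Proposition. (1) $\mathrm{REG}/\!/\mathrm{NFASV_t}\nsubseteq\mathrm{CFL}$ and $\mathrm{CFL}\nsubseteq\mathrm{REG}/\!/\mathrm{NFAMV}$. (2) $\mathrm{REG}/\!/\mathrm{NFASV_t}$ is closed under complement, but $\mathrm{REG}/\!/\mathrm{NFAMV}$ is not. (3) $\mathrm{CFL}\cap\mathrm{co}\,\mathrm{CFL}\subsetneqq\mathrm{REG}/\!/\mathrm{CFLSV_t}$. -/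

import Mathlib

/-! ### Language families over finite alphabets -/

/-- A family of languages: for every finite alphabet, a set of languages over that alphabet. -/
abbrev LanguageFamily : Type 1 := ∀ (α : Type) [Finite α], Set (Language α)

namespace LanguageFamily

/-- Containment of language families (over every finite alphabet). -/
def Contained (C D : LanguageFamily) : Prop :=
  ∀ (α : Type) [Finite α], C α ⊆ D α

/-- Proper containment of language families. -/
def ProperlyContained (C D : LanguageFamily) : Prop :=
  C.Contained D ∧ ¬ D.Contained C

/-- Intersection of language families. -/
def inter (C D : LanguageFamily) : LanguageFamily := fun α _ => C α ∩ D α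

/-- The family of the complements (relative to the set of all words over the alphabet) of the
languages in `C`. -/
def co (C : LanguageFamily) : LanguageFamily := fun α _ => {L | Lᶜ ∈ C α}

/-- Closure under complement. -/
def ClosedUnderCompl (C : LanguageFamily) : Prop :=
  ∀ (α : Type) [Finite α], ∀ L ∈ C α, Lᶜ ∈ C α

end LanguageFamily

/-- The family of regular languages. -/
def REG : LanguageFamily := fun _ _ => {L | L.IsRegular}

/-- The family of context-free languages. -/
def CFL : LanguageFamily := fun _ _ => {L | L.IsContextFree}

/-! ### Multi-valued partial functions -/

/-- Multi-valued partial functions from words over `α` to words over `β`; the function is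
undefined at `x` when its value there is empty. -/
abbrev MVFun (α β : Type) : Type := List α → Set (List β)

/-- A class of multi-valued partial functions between words over finite alphabets. -/
abbrev FunctionClass : Type 1 := ∀ (α β : Type) [Finite α] [Finite β], Set (MVFun α β)

namespace FunctionClass

/-- The single-valued partial functions of a class. -/
def singleValued (F : FunctionClass) : FunctionClass :=
  fun α β _ _ => {f | f ∈ F α β ∧ ∀ x, (f x).Subsingleton}

/-- The total functions of a class. -/
def total (F : FunctionClass) : FunctionClass :=
  fun α β _ _ => {f | f ∈ F α β ∧ ∀ x, (f x).Nonempty}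

end FunctionClass

/-! ### Computation paths -/

/-- `StepsTo r n c d`: there is a computation path of exactly `n` steps of `r` from `c` to `d`. -/
inductive StepsTo {C : Type} (r : C → C → Prop) : ℕ → C → C → Prop
  | zero (c : C) : StepsTo r 0 c c
  | succ {n : ℕ} {c d e : C} : StepsTo r n c d → r d e → StepsTo r (n + 1) c e

/-- The termination condition: for some linear polynomial `a * n + b`, every computation path on an
input of length `n` has at most `a * n + b` steps, and every computation path that cannot be
continued has reached a halting configuration. -/
def TerminatesInLinearTime {α C : Type} (r : C → C → Prop) (halting : C → Prop)
    (init : List α → C) : Prop :=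
  ∃ a b : ℕ, ∀ (x : List α) (n : ℕ) (c : C), StepsTo r n (init x) c →
    n ≤ a * x.length + b ∧ ((∀ d, ¬ r c d) → halting c)

/-- Input-tape symbols: the letters of the input alphabet and the two endmarkers. -/
inductive TapeSymbol (α : Type) : Type
  | leftEnd : TapeSymbol α
  | letter (a : α) : TapeSymbol α
  | rightEnd : TapeSymbol α

/-- The content of the input tape: the input between the two endmarkers. -/
def inputTape {α : Type} (x : List α) : List (TapeSymbol α) :=
  TapeSymbol.leftEnd :: (x.map TapeSymbol.letter ++ [TapeSymbol.rightEnd])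

/-! ### One-way nondeterministic pushdown automata with a write-only output tape -/

/-- A one-way one-head nondeterministic pushdown automaton with input alphabet `α`, output
alphabet `β`, inner states `Q` and stack alphabet `Θ`. In `δ q s Z`, the argument `s = none`
stands for a move that reads no input symbol (a `λ`-move), and in an element `(p, w, o)` of
`δ q s Z` the word `w` replaces the top symbol `Z` (the first letter of `w` becomes the new top)
and `o = none` means that nothing is written. -/
structure PDATransducer (α β Q Θ : Type) where
  δ : Q → Option (TapeSymbol α) → Θ → Set (Q × List Θ × Option β)
  δ_finite : ∀ q s Z, (δ q s Z).Finite
  start : Q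
  bottom : Θ
  acc : Set Q
  rej : Set Q
  disjoint : Disjoint acc rej

namespace PDATransducer

variable {α β Q Θ : Type}

/-- A configuration: inner state, unread part of the input tape, stack (top first), output. -/
structure Cfg (α β Q Θ : Type) where
  state : Q
  input : List (TapeSymbol α)
  stack : List Θ
  output : List β

/-- The initial configuration on input `x`. -/
def init (M : PDATransducer α β Q Θ) (x : List α) : Cfg α β Q Θ :=
  ⟨M.start, inputTape x, [M.bottom], []⟩

/-- One move. `s.toList` is the word of length at most one that is read from the input tape and
`o.toList` the one that is written. No move is possible in a halting state. -/
def Step (M : PDATransducer α β Q Θ) (c d : Cfg α β Q Θ) : Prop :=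
  c.state ∉ M.acc ∪ M.rej ∧
    ∃ (s : Option (TapeSymbol α)) (Z : Θ) (w v : List Θ) (o : Option β),
      (d.state, w, o) ∈ M.δ c.state s Z ∧ c.input = s.toList ++ d.input ∧
      c.stack = Z :: v ∧ d.stack = w ++ v ∧ d.output = c.output ++ o.toList

/-- The termination condition of the machine. -/
def Terminates (M : PDATransducer α β Q Θ) : Prop :=
  TerminatesInLinearTime M.Step (fun c => c.state ∈ M.acc ∪ M.rej) M.init

/-- The multi-valued partial function computed by the machine: the set of the outputs along the
accepting computation paths. -/
def function (M : PDATransducer α β Q Θ) : MVFun α β := fun x =>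
  {y | ∃ (n : ℕ) (c : Cfg α β Q Θ), StepsTo M.Step n (M.init x) c ∧ c.state ∈ M.acc ∧ c.output = y}

end PDATransducer

/-! ### One-way nondeterministic finite automata with a write-only output tape -/

/-- A one-way one-head nondeterministic finite automaton with input alphabet `α`, output alphabet
`β` and inner states `Q`; `none` stands for a `λ`-move, respectively for writing nothing. -/
structure NFATransducer (α β Q : Type) where
  δ : Q → Option (TapeSymbol α) → Set (Q × Option β)
  start : Q
  acc : Set Q
  rej : Set Q
  disjoint : Disjoint acc rej

namespace NFATransducer

variable {α β Q : Type}

/-- A configuration: inner state, unread part of the input tape, output. -/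
structure Cfg (α β Q : Type) where
  state : Q
  input : List (TapeSymbol α)
  output : List β

/-- The initial configuration on input `x`. -/
def init (M : NFATransducer α β Q) (x : List α) : Cfg α β Q :=
  ⟨M.start, inputTape x, []⟩

/-- One move; no move is possible in a halting state. -/
def Step (M : NFATransducer α β Q) (c d : Cfg α β Q) : Prop :=
  c.state ∉ M.acc ∪ M.rej ∧
    ∃ (s : Option (TapeSymbol α)) (o : Option β),
      (d.state, o) ∈ M.δ c.state s ∧ c.input = s.toList ++ d.input ∧
      d.output = c.output ++ o.toList

/-- The termination condition of the machine. -/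
def Terminates (M : NFATransducer α β Q) : Prop :=
  TerminatesInLinearTime M.Step (fun c => c.state ∈ M.acc ∪ M.rej) M.init

/-- The multi-valued partial function computed by the machine: the set of the outputs along the
accepting computation paths. -/
def function (M : NFATransducer α β Q) : MVFun α β := fun x =>
  {y | ∃ (n : ℕ) (c : Cfg α β Q), StepsTo M.Step n (M.init x) c ∧ c.state ∈ M.acc ∧ c.output = y}

end NFATransducer

/-! ### The function classes -/

/-- The functions computed by pushdown automata with an output tape under the termination
condition. -/
def CFLMV : FunctionClass := fun α β _ _ =>
  {f | ∃ (Q Θ : Type) (_ : Finite Q) (_ : Finite Θ) (M : PDATransducer α β Q Θ),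
    M.Terminates ∧ M.function = f}

/-- The single-valued total functions in `CFLMV`. -/
def CFLSVt : FunctionClass := CFLMV.singleValued.total

/-- The functions computed by finite automata with an output tape under the termination
condition. -/
def NFAMV : FunctionClass := fun α β _ _ =>
  {f | ∃ (Q : Type) (_ : Finite Q) (M : NFATransducer α β Q), M.Terminates ∧ M.function = f}

/-- The single-valued total functions in `NFAMV`. -/
def NFASVt : FunctionClass := NFAMV.singleValued.total

/-! ### The advice operator -/

/-- The two-track word with upper track `x` and lower track `y`; the shorter of the two is padded
at its end by the new symbol `none`. -/
def track {α β : Type} (x : List α) (y : List β) : List (Option α × Option β) :=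
  List.zipWithAll Prod.mk x y

/-- The family `C // F`: all languages `{x | ∃ y ∈ h x, track x y ∈ B}` with `B ∈ C`, `h ∈ F`. -/
def Advice (C : LanguageFamily) (F : FunctionClass) : LanguageFamily := fun α _ =>
  {L | ∃ (β : Type) (_ : Finite β) (B : Language (Option α × Option β)) (h : MVFun α β),
    B ∈ C (Option α × Option β) ∧ h ∈ F α β ∧ ∀ x, x ∈ L ↔ ∃ y ∈ h x, track x y ∈ B}

/-! ### Languages given by a condition on the letters -/

/-! Positive examples. Erasing the zeros of `0 ^ n * 1 ^ n * 2 ^ n` shifts the other blocks by n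
places, so a regular condition on the columns of the two-track word compares the block lengths. This
puts the non-context-free `shiftLanguage` into REG//NFASV_t, hence also into REG//CFLSV_t.
Non-palindromes are in REG//NFAMV: guess a letter and write it below its mirror position. For
single-valued total advice, complementing the regular language complements the result.

Context-free languages enter through `IsBinaryFamily`, a finite family of languages in which every
word of length at least two splits into two nonempty exchangeable parts. Exchanging factors proves
that `shiftLanguage` is not context-free. The same splittings drive a shift-reduce pushdown
transducer; run on a family for a language together with one for its complement, it writes the
membership bit of its input, which gives the inclusion in (3).

The remaining negative claims both follow from `palindromes_not_mem_advice`. A computation with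
advice is simulated by two one-way heads on the input, one running the transducer and the other
running the automaton on the two tracks. In words u v vᴿ uᴿ either both heads are at some time
between the two outer blocks, and one configuration has to determine u, or one head crosses the
whole middle while the other is still before it, and three configurations have to determine v once u
is fixed. There are only polynomially many configurations (`not_twoHead_palindromes`). -/

theorem isRegular_forall_mem {α : Type} (P : α → Prop) :
    Language.IsRegular {w : List α | ∀ p ∈ w, P p} := by
  classical
  let M : DFA α Bool := ⟨fun b a => b && decide (P a), true, {true}⟩
  have key : ∀ (w : List α) (b : Bool), M.evalFrom b w = true ↔ b = true ∧ ∀ p ∈ w, P p := by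
    intro w
    induction w with
    | nil => simp
    | cons a w ih =>
      intro b
      rw [DFA.evalFrom_cons, ih]
      simp [M, and_assoc]
  refine ⟨Bool, inferInstance, M, ?_⟩
  ext w
  exact (key w true).trans (by simp; rfl)

theorem isRegular_exists_mem {α : Type} (P : α → Prop) :
    Language.IsRegular {w : List α | ∃ p ∈ w, P p} := by
  have h := (isRegular_forall_mem (fun a => ¬ P a)).compl
  have e : ({w | ∃ p ∈ w, P p} : Language α) = ({w | ∀ p ∈ w, ¬ P p} : Language α)ᶜ := by
    ext w
    change (∃ p ∈ w, P p) ↔ ¬ ∀ p ∈ w, ¬ P p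
    push Not
    rfl
  exact e ▸ h

/-! ### Binary decompositions of the words of a context-free language -/

namespace ContextFreeGrammar

variable {T : Type} {g : ContextFreeGrammar T}

/-- `g.Yields s w`: the sentential form `s` derives the word `w`, as a parse forest. -/
inductive Yields (g : ContextFreeGrammar T) : List (Symbol T g.NT) → List T → Prop
  | nil : Yields g [] []
  | terminal (a : T) {s : List (Symbol T g.NT)} {w : List T} :
      Yields g s w → Yields g (Symbol.terminal a :: s) (a :: w)
  | nonterminal {r : ContextFreeRule T g.NT} {s : List (Symbol T g.NT)} {u v : List T} :
      r ∈ g.rules → Yields g r.output u → Yields g s v →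
      Yields g (Symbol.nonterminal r.input :: s) (u ++ v)

theorem Yields.append {s t : List (Symbol T g.NT)} {u v : List T} (hs : g.Yields s u)
    (ht : g.Yields t v) : g.Yields (s ++ t) (u ++ v) := by
  induction hs with
  | nil => exact ht
  | terminal a _ ih => exact ih.terminal a
  | nonterminal hr h _ _ ih => simpa using Yields.nonterminal hr h ih

theorem Yields.exists_of_append {s t : List (Symbol T g.NT)} {w : List T}
    (h : g.Yields (s ++ t) w) : ∃ u v, w = u ++ v ∧ g.Yields s u ∧ g.Yields t v := by
  induction s generalizing w with
  | nil => exact ⟨[], w, rfl, .nil, h⟩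
  | cons X s ih =>
    rw [List.cons_append] at h
    cases h with
    | terminal a h =>
      obtain ⟨u, v, rfl, hu, hv⟩ := ih h
      exact ⟨a :: u, v, rfl, hu.terminal a, hv⟩
    | nonterminal hr h₁ h =>
      obtain ⟨u, v, rfl, hu, hv⟩ := ih h
      exact ⟨_, v, (List.append_assoc _ _ _).symm, .nonterminal hr h₁ hu, hv⟩

theorem yields_terminal (w : List T) : g.Yields (w.map Symbol.terminal) w := by
  induction w with
  | nil => exact .nil
  | cons a w ih => exact ih.terminal a

theorem Yields.of_rewrites {r : ContextFreeRule T g.NT} (hr : r ∈ g.rules)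
    {s t : List (Symbol T g.NT)} (h : r.Rewrites s t) {w : List T} (ht : g.Yields t w) :
    g.Yields s w := by
  induction h generalizing w with
  | head s =>
    obtain ⟨u, v, rfl, hu, hv⟩ := ht.exists_of_append
    exact .nonterminal hr hu hv
  | cons X _ ih =>
    cases ht with
    | terminal a h => exact (ih h).terminal a
    | nonterminal hr' h₁ h => exact .nonterminal hr' h₁ (ih h)

theorem derives_iff_yields {s : List (Symbol T g.NT)} {w : List T} :
    g.Derives s (w.map Symbol.terminal) ↔ g.Yields s w := by
  constructor
  · intro h
    induction h using Relation.ReflTransGen.head_induction_on with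
    | refl => exact yields_terminal w
    | head h _ ih =>
      obtain ⟨r, hr, h⟩ := h
      exact ih.of_rewrites hr h
  · intro h
    induction h with
    | nil => exact Derives.refl _
    | terminal a _ ih => exact ih.append_left [Symbol.terminal a]
    | @nonterminal r s u v hr _ _ ih₁ ih₂ =>
      have h₁ : g.Produces (Symbol.nonterminal r.input :: s) (r.output ++ s) :=
        ⟨r, hr, .head s⟩
      rw [List.map_append]
      exact h₁.trans_derives ((ih₁.append_right s).trans (ih₂.append_left _))

/-- The words derived from a sentential form. -/
def formLanguage (g : ContextFreeGrammar T) (s : List (Symbol T g.NT)) : Language T :=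
  {w | g.Yields s w}

/-- The factors of the right-hand sides and of the initial form. -/
def forms (g : ContextFreeGrammar T) : Set (List (Symbol T g.NT)) :=
  {t | t <:+: [Symbol.nonterminal g.initial] ∨ ∃ r ∈ g.rules, t <:+: r.output}

theorem finite_forms (g : ContextFreeGrammar T) : g.forms.Finite := by
  have key : ∀ f : List (Symbol T g.NT), {t | t <:+: f}.Finite := fun f =>
    (List.finite_toSet f.sublists).subset fun t ht => List.mem_sublists.2 ht.sublist
  have h : g.forms = {t | t <:+: [Symbol.nonterminal g.initial]} ∪
      ⋃ r ∈ (g.rules : Set (ContextFreeRule T g.NT)), {t | t <:+: r.output} := by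
    ext t
    simp [forms]
  rw [h]
  exact (key _).union (g.rules.finite_toSet.biUnion fun r _ => key _)

theorem forms_of_infix {s t : List (Symbol T g.NT)} (h : s ∈ g.forms) (hts : t <:+: s) :
    t ∈ g.forms :=
  h.imp hts.trans fun ⟨r, hr, h⟩ => ⟨r, hr, hts.trans h⟩

/-- Descend in the parse forest, skipping trees and remainders with empty yield, until the word
divides into two nonempty parts. The two forms found there are factors of right-hand sides or of the
initial form, so finitely many forms suffice. This replaces a normal form of the grammar. -/
theorem Yields.exists_split {s : List (Symbol T g.NT)} {w : List T} (h : g.Yields s w)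
    (hs : s ∈ g.forms) (hw : 2 ≤ w.length) :
    ∃ u v, ∃ s₁ ∈ g.forms, ∃ s₂ ∈ g.forms, w = u ++ v ∧ u ≠ [] ∧ v ≠ [] ∧
      g.Yields s₁ u ∧ g.Yields s₂ v ∧ ∀ u' v', g.Yields s₁ u' → g.Yields s₂ v' →
        g.Yields s (u' ++ v') := by
  induction h with
  | nil => simp at hw
  | @terminal a s w h _ =>
    refine ⟨[a], w, [Symbol.terminal a], forms_of_infix hs ⟨[], s, by simp⟩, s,
      forms_of_infix hs ⟨[Symbol.terminal a], [], by simp⟩, rfl, by simp, ?_,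
      yields_terminal [a], h, fun u' v' h₁ h₂ => h₁.append h₂⟩
    rintro rfl
    simp at hw
  | @nonterminal r s u v hr hu hv ihu ihv =>
    have hs' : s ∈ g.forms :=
      forms_of_infix hs ⟨[Symbol.nonterminal r.input], [], by simp⟩
    rcases eq_or_ne u [] with rfl | hu₀
    · obtain ⟨u₁, v₁, s₁, h₁, s₂, h₂, e, n₁, n₂, y₁, y₂, y⟩ := ihv hs' hw
      exact ⟨u₁, v₁, s₁, h₁, s₂, h₂, e, n₁, n₂, y₁, y₂,
        fun u' v' h₁ h₂ => by simpa using Yields.nonterminal hr hu (y u' v' h₁ h₂)⟩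
    rcases eq_or_ne v [] with rfl | hv₀
    · rw [List.append_nil] at hw ⊢
      obtain ⟨u₁, v₁, s₁, h₁, s₂, h₂, e, n₁, n₂, y₁, y₂, y⟩ :=
        ihu (Or.inr ⟨r, hr, List.infix_rfl⟩) hw
      exact ⟨u₁, v₁, s₁, h₁, s₂, h₂, e, n₁, n₂, y₁, y₂,
        fun u' v' h₁ h₂ => by simpa using Yields.nonterminal hr (y u' v' h₁ h₂) hv⟩
    · refine ⟨u, v, [Symbol.nonterminal r.input], forms_of_infix hs ⟨[], s, by simp⟩, s, hs',
        rfl, hu₀, hv₀, ?_, hv, fun u' v' h₁ h₂ => h₁.append h₂⟩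
      simpa using Yields.nonterminal hr hu .nil

end ContextFreeGrammar

/-- A family of languages in which every word with at least two letters splits into nonempty words
of two members whose product is contained in the language considered. -/
def IsBinaryFamily {α N : Type} (F : N → Language α) : Prop :=
  ∀ n, ∀ w ∈ F n, 2 ≤ w.length → ∃ u v n₁ n₂, w = u ++ v ∧ u ≠ [] ∧ v ≠ [] ∧
    u ∈ F n₁ ∧ v ∈ F n₂ ∧ F n₁ * F n₂ ≤ F n

theorem Language.IsContextFree.exists_isBinaryFamily {α : Type} {L : Language α}
    (h : L.IsContextFree) :
    ∃ (N : Type) (_ : Finite N) (F : N → Language α) (s : N), F s = L ∧ IsBinaryFamily F := by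
  obtain ⟨g, rfl⟩ := h
  have : Finite g.forms := g.finite_forms
  refine ⟨g.forms, this, fun s => g.formLanguage s,
    ⟨[Symbol.nonterminal g.initial], Or.inl List.infix_rfl⟩, ?_, ?_⟩
  · ext w
    exact ContextFreeGrammar.derives_iff_yields.symm
  · rintro ⟨s, hs⟩ w hw hl
    obtain ⟨u, v, s₁, h₁, s₂, h₂, e, n₁, n₂, y₁, y₂, y⟩ :=
      ContextFreeGrammar.Yields.exists_split hw hs hl
    refine ⟨u, v, ⟨s₁, h₁⟩, ⟨s₂, h₂⟩, e, n₁, n₂, y₁, y₂, ?_⟩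
    rintro _ ⟨u', hu', v', hv', rfl⟩
    exact y u' v' hu' hv'

theorem IsBinaryFamily.sumElim {α N N' : Type} {F : N → Language α} {F' : N' → Language α}
    (h : IsBinaryFamily F) (h' : IsBinaryFamily F') : IsBinaryFamily (Sum.elim F F') := by
  rintro (n | n) w hw hl
  · obtain ⟨u, v, n₁, n₂, H⟩ := h n w hw hl
    exact ⟨u, v, .inl n₁, .inl n₂, H⟩
  · obtain ⟨u, v, n₁, n₂, H⟩ := h' n w hw hl
    exact ⟨u, v, .inr n₁, .inr n₂, H⟩

/-- A factor of prescribed size that can be exchanged for any word of the same member. -/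
theorem IsBinaryFamily.exists_factor {α N : Type} {F : N → Language α} (h : IsBinaryFamily F)
    {k : ℕ} (hk : 0 < k) (n : N) (w : List α) (hw : w ∈ F n) (hl : k ≤ w.length) :
    ∃ (x u y : List α) (m : N), w = x ++ u ++ y ∧ k ≤ u.length ∧ u.length < 2 * k ∧ u ∈ F m ∧
      ∀ u' ∈ F m, x ++ u' ++ y ∈ F n := by
  induction hN : w.length using Nat.strong_induction_on generalizing n w with
  | _ N ih =>
    rcases lt_or_ge w.length (2 * k) with hlt | hge
    · exact ⟨[], w, [], n, by simp, hl, hlt, hw, fun u' hu' => by simpa using hu'⟩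
    obtain ⟨u, v, n₁, n₂, rfl, hu, hv, hu', hv', hle⟩ := h n w hw (by omega)
    have hu₀ := List.length_pos_iff.2 hu
    have hv₀ := List.length_pos_iff.2 hv
    rw [List.length_append] at hN hge
    -- The whole has at least 2k letters, so one of the two parts still has at least k; the descent
    -- continues there.
    rcases le_or_gt k u.length with hku | hku
    · obtain ⟨x, t, y, m, rfl, h₁, h₂, h₃, h₄⟩ := ih u.length (by omega) n₁ u hu' hku rfl
      refine ⟨x, t, y ++ v, m, by simp, h₁, h₂, h₃, fun t' ht' => ?_⟩
      have H : x ++ t' ++ y ++ v ∈ F n := hle (Language.append_mem_mul (h₄ t' ht') hv')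
      simpa using H
    · obtain ⟨x, t, y, m, rfl, h₁, h₂, h₃, h₄⟩ :=
        ih v.length (by omega) n₂ v hv' (by omega) rfl
      refine ⟨u ++ x, t, y, m, by simp, h₁, h₂, h₃, fun t' ht' => ?_⟩
      have H : u ++ (x ++ t' ++ y) ∈ F n := hle (Language.append_mem_mul hu' (h₄ t' ht'))
      simpa using H

/-! ### Computation paths -/

theorem exists_stepsTo_iff {C : Type} {r : C → C → Prop} {c d : C} :
    (∃ n, StepsTo r n c d) ↔ Relation.ReflTransGen r c d := by
  constructor
  · rintro ⟨n, h⟩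
    induction h with
    | zero => exact .refl
    | succ _ h ih => exact ih.tail h
  · intro h
    induction h with
    | refl => exact ⟨0, .zero _⟩
    | tail _ h ih =>
      obtain ⟨n, hn⟩ := ih
      exact ⟨n + 1, hn.succ h⟩

theorem StepsTo.invariant {C : Type} {r : C → C → Prop} {P : C → Prop}
    (h : ∀ c d, P c → r c d → P d) {n : ℕ} {c d : C} (hcd : StepsTo r n c d) (hc : P c) : P d := by
  induction hcd with
  | zero => exact hc
  | succ _ hr ih => exact h _ _ (ih hc) hr

/-- A potential that drops at every step; the linear time bounds of the transducers come from it. -/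
theorem StepsTo.add_le {C : Type} {r : C → C → Prop} (μ : C → ℕ)
    (h : ∀ c d, r c d → μ d < μ c) {n : ℕ} {c d : C} (hcd : StepsTo r n c d) : n + μ d ≤ μ c := by
  induction hcd with
  | zero => simp
  | succ _ hr ih =>
    have := h _ _ hr
    omega

theorem length_inputTape {α : Type} (x : List α) : (inputTape x).length = x.length + 2 := by
  simp [inputTape]

theorem rightEnd_mem_inputTape {α : Type} (x : List α) : TapeSymbol.rightEnd ∈ inputTape x := by
  simp [inputTape]

/-! ### The two-track word -/

/-- The padding symbol `none` coincides with the value of a lookup beyond the end of a list, so both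
tracks become plain lookups. -/
theorem track_eq_map_range {α β : Type} (x : List α) (y : List β) :
    track x y = (List.range (max x.length y.length)).map fun k => (x[k]?, y[k]?) := by
  apply List.ext_getElem?
  intro k
  rw [track, List.getElem?_zipWithAll, List.getElem?_map]
  by_cases h : k < max x.length y.length
  · rw [List.getElem?_range h]
    rcases hx : x[k]? with _ | a <;> rcases hy : y[k]? with _ | b <;>
      simp [hx, hy]
    rw [List.getElem?_eq_none_iff] at hx hy
    omega
  · have h₁ : x[k]? = none := List.getElem?_eq_none (by omega)
    have h₂ : y[k]? = none := List.getElem?_eq_none (by omega)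
    simp [h₁, h₂]
    omega

theorem mem_track {α β : Type} {x : List α} {y : List β} {p : Option α × Option β} :
    p ∈ track x y ↔ ∃ k, (k < x.length ∨ k < y.length) ∧ p = (x[k]?, y[k]?) := by
  simp [track_eq_map_range, eq_comm]

/-! ### Finite transducers -/

namespace NFATransducer

variable {α β Q : Type} (M : NFATransducer α β Q)

/-- `M.Emits q t y`: started in the state `q` with unread tape `t`, some accepting path of `M`
writes `y`. -/
inductive Emits : Q → List (TapeSymbol α) → List β → Prop
  | halt {q : Q} (t : List (TapeSymbol α)) : q ∈ M.acc → Emits q t []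
  | step {q p : Q} {s : Option (TapeSymbol α)} {o : Option β} {t : List (TapeSymbol α)}
      {y : List β} : q ∉ M.acc ∪ M.rej → (p, o) ∈ M.δ q s → Emits p t y →
      Emits q (s.toList ++ t) (o.toList ++ y)

variable {M}

theorem Emits.exists_run {q : Q} {t : List (TapeSymbol α)} {y : List β} (h : M.Emits q t y)
    (z : List β) : ∃ c, Relation.ReflTransGen M.Step ⟨q, t, z⟩ c ∧ c.state ∈ M.acc ∧
      c.output = z ++ y := by
  induction h generalizing z with
  | halt t h => exact ⟨_, .refl, h, by simp⟩
  | @step q p s o t y hq hδ _ ih =>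
    obtain ⟨c, hc, ha, ho⟩ := ih (z ++ o.toList)
    refine ⟨c, .head ⟨hq, s, o, hδ, rfl, rfl⟩ hc, ha, by simp [ho]⟩

theorem emits_of_run {c d : Cfg α β Q} (h : Relation.ReflTransGen M.Step c d)
    (ha : d.state ∈ M.acc) : ∃ y, M.Emits c.state c.input y ∧ d.output = c.output ++ y := by
  induction h using Relation.ReflTransGen.head_induction_on with
  | refl => exact ⟨[], .halt _ ha, by simp⟩
  | head hs _ ih =>
    obtain ⟨y, hy, e⟩ := ih
    obtain ⟨hq, s, o, hδ, hi, ho⟩ := hs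
    refine ⟨o.toList ++ y, ?_, by rw [e, ho, List.append_assoc]⟩
    rw [hi]
    exact .step hq hδ hy

theorem mem_function_iff {x : List α} {y : List β} :
    y ∈ M.function x ↔ M.Emits M.start (inputTape x) y := by
  constructor
  · rintro ⟨n, c, h, ha, rfl⟩
    obtain ⟨y, hy, e⟩ := emits_of_run (exists_stepsTo_iff.1 ⟨n, h⟩) ha
    have e' : c.output = y := e
    exact e' ▸ hy
  · intro h
    obtain ⟨c, hc, ha, ho⟩ := h.exists_run []
    obtain ⟨n, hn⟩ := exists_stepsTo_iff.2 hc
    exact ⟨n, c, hn, ha, ho⟩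

theorem emits_of_mem_acc {q : Q} (h : q ∈ M.acc) {t : List (TapeSymbol α)} {y : List β} :
    M.Emits q t y ↔ y = [] := by
  constructor
  · rintro (⟨_, _⟩ | ⟨hq, _, _⟩)
    · rfl
    · exact (hq (Or.inl h)).elim
  · rintro rfl
    exact .halt _ h

theorem not_emits_of_mem_rej {q : Q} (h : q ∈ M.rej) {t : List (TapeSymbol α)} {y : List β} :
    ¬ M.Emits q t y := by
  rintro (⟨_, ha⟩ | ⟨hq, _, _⟩)
  · exact Set.disjoint_left.1 M.disjoint ha h
  · exact hq (Or.inr h)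

theorem emits_cons {q : Q} (hq : q ∉ M.acc ∪ M.rej) (hl : M.δ q none = ∅) {a : TapeSymbol α}
    {t : List (TapeSymbol α)} {y : List β} :
    M.Emits q (a :: t) y ↔ ∃ p o z, (p, o) ∈ M.δ q (some a) ∧ M.Emits p t z ∧
      y = o.toList ++ z := by
  constructor
  · intro h
    generalize e : a :: t = t' at h
    cases h with
    | halt _ ha => exact (hq (Or.inl ha)).elim
    | @step _ p s o t' z _ hδ h =>
      rcases s with _ | b
      · simp [hl] at hδ
      · simp only [Option.toList_some, List.singleton_append, List.cons.injEq] at e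
        obtain ⟨rfl, rfl⟩ := e
        exact ⟨p, o, z, hδ, h, rfl⟩
  · rintro ⟨p, o, z, hδ, h, rfl⟩
    exact .step (s := some a) hq hδ h

/-- Every step consumes one of the n + 2 cells of the tape. Reading the right endmarker halts, so
outside the halting states that marker is still unread and some move is possible. -/
theorem terminates_of_reading (hl : ∀ q, M.δ q none = ∅)
    (hn : ∀ q, q ∉ M.acc ∪ M.rej → ∀ a, (M.δ q (some a)).Nonempty)
    (hr : ∀ q p o, (p, o) ∈ M.δ q (some .rightEnd) → p ∈ M.acc ∪ M.rej) : M.Terminates := by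
  refine ⟨1, 2, fun x n c h => ⟨?_, fun hc => ?_⟩⟩
  · have := h.add_le (fun c => c.input.length) fun c d ⟨_, s, o, hδ, hi, _⟩ => by
      rcases s with _ | a
      · simp [hl] at hδ
      · simp [hi]
    simp only [init, length_inputTape] at this
    omega
  · by_contra hq
    have inv := h.invariant
      (P := fun c => c.state ∉ M.acc ∪ M.rej → TapeSymbol.rightEnd ∈ c.input)
      (fun c d hc ⟨hq, s, o, hδ, hi, _⟩ hd => by
        rcases s with _ | a
        · simp [hl] at hδ
        · have := hc hq
          rw [hi] at this
          rcases List.mem_append.1 this with ha | ha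
          · simp only [Option.toList_some, List.mem_singleton] at ha
            exact (hd (hr _ _ _ (ha ▸ hδ))).elim
          · exact ha)
      fun _ => rightEnd_mem_inputTape x
    obtain ⟨a, t, e⟩ := List.exists_cons_of_ne_nil (List.ne_nil_of_mem (inv hq))
    obtain ⟨⟨p, o⟩, hp⟩ := hn _ hq a
    exact hc ⟨p, t, c.output ++ o.toList⟩ ⟨hq, some a, o, hp, e, rfl⟩

/-- A finite transducer as a pushdown transducer with a constant stack. -/
def toPDA [Finite β] [Finite Q] (M : NFATransducer α β Q) : PDATransducer α β Q Unit where
  δ q s _ := (fun p : Q × Option β => (p.1, [()], p.2)) '' M.δ q s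
  δ_finite _ _ _ := (Set.toFinite _).image _
  start := M.start
  bottom := ()
  acc := M.acc
  rej := M.rej
  disjoint := M.disjoint

variable [Finite β] [Finite Q]

/-- The configuration of `M.toPDA` that corresponds to a configuration of `M`. -/
def Cfg.toPDA (c : Cfg α β Q) : PDATransducer.Cfg α β Q Unit := ⟨c.state, c.input, [()], c.output⟩

theorem toPDA_step_iff {c : Cfg α β Q} {d : PDATransducer.Cfg α β Q Unit} :
    M.toPDA.Step c.toPDA d ↔ ∃ d', M.Step c d' ∧ d = d'.toPDA := by
  constructor
  · rintro ⟨hq, s, Z, w, v, o, ⟨⟨p, o'⟩, hδ, e⟩, hi, hs, hs', ho⟩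
    simp only [Prod.mk.injEq] at e
    obtain ⟨e₁, rfl, rfl⟩ := e
    simp only [Cfg.toPDA, List.cons.injEq] at hs
    obtain ⟨-, rfl⟩ := hs
    refine ⟨⟨d.state, d.input, d.output⟩, ⟨hq, s, o', e₁ ▸ hδ, hi, ho⟩, ?_⟩
    rcases d with ⟨a, b, c, d⟩
    simp only at hs'
    simp [Cfg.toPDA, hs']
  · rintro ⟨d', ⟨hq, s, o, hδ, hi, ho⟩, rfl⟩
    exact ⟨hq, s, (), [()], [], o, ⟨_, hδ, rfl⟩, hi, rfl, rfl, ho⟩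

theorem toPDA_stepsTo_iff {n : ℕ} {c : Cfg α β Q} {d : PDATransducer.Cfg α β Q Unit} :
    StepsTo M.toPDA.Step n c.toPDA d ↔ ∃ d', StepsTo M.Step n c d' ∧ d = d'.toPDA := by
  constructor
  · intro h
    generalize e : c.toPDA = c' at h
    induction h with
    | zero => exact ⟨c, .zero c, e.symm⟩
    | succ _ hs ih =>
      obtain ⟨d', hd', rfl⟩ := ih e
      obtain ⟨d'', hd'', rfl⟩ := toPDA_step_iff.1 hs
      exact ⟨d'', hd'.succ hd'', rfl⟩
  · rintro ⟨d', h, rfl⟩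
    induction h with
    | zero => exact .zero _
    | succ _ hs ih => exact ih.succ (toPDA_step_iff.2 ⟨_, hs, rfl⟩)

theorem toPDA_function : M.toPDA.function = M.function := by
  funext x
  ext y
  constructor
  · rintro ⟨n, c, h, ha, rfl⟩
    obtain ⟨d, hd, rfl⟩ := (toPDA_stepsTo_iff (c := M.init x)).1 h
    exact ⟨n, d, hd, ha, rfl⟩
  · rintro ⟨n, c, h, ha, rfl⟩
    exact ⟨n, c.toPDA, (toPDA_stepsTo_iff (c := M.init x)).2 ⟨c, h, rfl⟩, ha, rfl⟩

theorem Terminates.toPDA (h : M.Terminates) : M.toPDA.Terminates := by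
  obtain ⟨a, b, h⟩ := h
  refine ⟨a, b, fun x n c hc => ?_⟩
  obtain ⟨d, hd, rfl⟩ := (toPDA_stepsTo_iff (c := M.init x)).1 hc
  exact ⟨(h x n d hd).1, fun hs => (h x n d hd).2
    fun e he => hs e.toPDA (toPDA_step_iff.2 ⟨e, he, rfl⟩)⟩

end NFATransducer

theorem NFAMV_subset_CFLMV (α β : Type) [Finite α] [Finite β] : NFAMV α β ⊆ CFLMV α β := by
  rintro _ ⟨Q, _, M, hM, rfl⟩
  exact ⟨Q, Unit, inferInstance, inferInstance, M.toPDA, hM.toPDA, M.toPDA_function⟩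

theorem Advice.mono {C : LanguageFamily} {F G : FunctionClass}
    (h : ∀ (α β : Type) [Finite α] [Finite β], F α β ⊆ G α β) :
    (Advice C F).Contained (Advice C G) := by
  rintro α _ L ⟨β, _, B, f, hB, hf, hL⟩
  exact ⟨β, inferInstance, B, f, hB, h _ _ hf, hL⟩

theorem advice_NFASVt_contained_advice_CFLSVt :
    (Advice REG NFASVt).Contained (Advice REG CFLSVt) :=
  Advice.mono fun α β _ _ _ hf => ⟨⟨NFAMV_subset_CFLMV α β hf.1.1, hf.1.2⟩, hf.2⟩

/-- With exactly one advice string per input, failing for all advice strings means succeeding with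
`Bᶜ` for that one. -/
theorem closedUnderCompl_advice_NFASVt : (Advice REG NFASVt).ClosedUnderCompl := by
  rintro α _ L ⟨β, _, B, h, hB, hh, hL⟩
  refine ⟨β, inferInstance, Bᶜ, h, Language.IsRegular.compl hB, hh, fun x => ?_⟩
  have e : x ∈ Lᶜ ↔ ¬ x ∈ L := Iff.rfl
  rw [e, hL]
  obtain ⟨y, hy⟩ := hh.2 x
  constructor
  · exact fun H => ⟨y, hy, fun hB => H ⟨y, hy, hB⟩⟩
  · rintro ⟨z, hz, hzB⟩ ⟨w, hw, hwB⟩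
    exact hzB (hh.1.2 x hz hw ▸ hwB)

/-! ### Words with the same number of occurrences of three letters -/

theorem length_eq_sum_count (w : List (Fin 3)) :
    w.length = w.count 0 + w.count 1 + w.count 2 := by
  induction w with
  | nil => rfl
  | cons a w ih =>
    fin_cases a <;> simp [ih] <;> omega

/-- The word `0 ^ n * 1 ^ n * 2 ^ n`. -/
def threeBlocks (n : ℕ) : List (Fin 3) :=
  List.replicate n 0 ++ List.replicate n 1 ++ List.replicate n 2

theorem getElem?_threeBlocks (n k : ℕ) : (threeBlocks n)[k]? =
    if k < n then some 0 else if k < 2 * n then some 1 else if k < 3 * n then some 2 else none := by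
  simp only [threeBlocks, List.getElem?_append, List.getElem?_replicate, List.length_append,
    List.length_replicate]
  split_ifs <;> first | rfl | omega

theorem length_threeBlocks (n : ℕ) : (threeBlocks n).length = 3 * n := by
  simp [threeBlocks]
  omega

theorem count_threeBlocks (n : ℕ) (a : Fin 3) : (threeBlocks n).count a = n := by
  fin_cases a <;> simp [threeBlocks, List.count_replicate]

/-- A factor containing both 0 and 2 has to contain the whole block of n ones as well, and so has
more than n letters. -/
theorem not_mem_factor_threeBlocks {n : ℕ} {x u y : List (Fin 3)}
    (h : threeBlocks n = x ++ u ++ y) (hu : u.length ≤ n) : 0 ∉ u ∨ 2 ∉ u := by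
  by_contra! H
  have key : ∀ i < u.length, u[i]? = (threeBlocks n)[x.length + i]? := fun i hi => by
    rw [h, List.append_assoc, List.getElem?_append_right (by omega), Nat.add_sub_cancel_left,
      List.getElem?_append_left hi]
  obtain ⟨i, hi, ei⟩ := List.mem_iff_getElem.1 H.1
  obtain ⟨j, hj, ej⟩ := List.mem_iff_getElem.1 H.2
  have h₁ := key i hi
  have h₂ := key j hj
  rw [List.getElem?_eq_getElem hi, ei, getElem?_threeBlocks] at h₁
  rw [List.getElem?_eq_getElem hj, ej, getElem?_threeBlocks] at h₂
  split_ifs at h₁ h₂ <;> first | omega | simp at h₁ h₂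

/-- Choose exchangeable factors in infinitely many words `threeBlocks`, each missing 0 or 2. By the
pigeonhole principle two of them belong to the same member and miss the same letter. Putting the
longer one in place of the shorter keeps the count of the missing letter, hence all three counts,
but increases the length. -/
theorem not_isContextFree_of_count_eq {L : Language (Fin 3)} (hL : ∀ n, threeBlocks n ∈ L)
    (hc : ∀ w ∈ L, w.count 0 = w.count 1 ∧ w.count 1 = w.count 2) : ¬ L.IsContextFree := by
  intro hcf
  obtain ⟨N, _, F, s, rfl, hF⟩ := hcf.exists_isBinaryFamily
  -- A factor has length in [3^i, 2 * 3^i): these intervals are disjoint and increasing in i, and no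
  -- factor is longer than a block.
  have step : ∀ i : ℕ, ∃ (x u y : List (Fin 3)) (m : N),
      threeBlocks (2 * 3 ^ i) = x ++ u ++ y ∧ 3 ^ i ≤ u.length ∧ u.length < 2 * 3 ^ i ∧
      u ∈ F m ∧ ∀ u' ∈ F m, x ++ u' ++ y ∈ F s := fun i =>
    hF.exists_factor (by positivity) s _ (hL _) (by rw [length_threeBlocks]; omega)
  choose x u y m hxy hlo hhi hm hex using step
  have hz : ∀ i, ∃ b : Bool, (if b then (0 : Fin 3) else 2) ∉ u i := fun i => by
    rcases not_mem_factor_threeBlocks (hxy i) (hhi i).le with h | h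
    · exact ⟨true, h⟩
    · exact ⟨false, h⟩
  choose b hb using hz
  obtain ⟨i, j, hij, e⟩ := Finite.exists_ne_map_eq_of_infinite fun i => (m i, b i)
  wlog hlt : i < j generalizing i j
  · exact this j i hij.symm e.symm (by omega)
  simp only [Prod.mk.injEq] at e
  obtain ⟨em, eb⟩ := e
  have hw := hex i (u j) (em ▸ hm j)
  have hl : (u i).length < (u j).length := by
    have h₁ := hhi i
    have h₂ := hlo j
    have h₃ : 3 ^ (i + 1) ≤ 3 ^ j := Nat.pow_le_pow_right (by norm_num) hlt
    rw [pow_succ] at h₃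
    omega
  set a : Fin 3 := if b i then 0 else 2 with ha
  have c₁ : (u i).count a = 0 := List.count_eq_zero.2 (hb i)
  have c₂ : (u j).count a = 0 := List.count_eq_zero.2 (by rw [ha, eb]; exact hb j)
  have c₃ : (x i).count a + (y i).count a = 2 * 3 ^ i := by
    have := count_threeBlocks (2 * 3 ^ i) a
    rw [hxy, List.count_append, List.count_append] at this
    omega
  have c₄ : (x i).length + (u i).length + (y i).length = 3 * (2 * 3 ^ i) := by
    have := length_threeBlocks (2 * 3 ^ i)
    rwa [hxy, List.length_append, List.length_append] at this
  have c₅ := length_eq_sum_count (x i ++ u j ++ y i)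
  have c₆ : (x i ++ u j ++ y i).count a = 2 * 3 ^ i := by
    rw [List.count_append, List.count_append]
    omega
  obtain ⟨h₁, h₂⟩ := hc _ hw
  rw [List.length_append, List.length_append] at c₅
  have h₃ : (x i ++ u j ++ y i).count 0 = 2 * 3 ^ i := by
    rcases hbi : b i <;> simp only [hbi, if_true, Bool.false_eq_true, if_false] at ha <;>
      rw [ha] at c₆ <;> omega
  omega

/-! ### A transducer that erases a letter -/

/-- The transducer that erases the letter `0` and copies the others. -/
def eraseZero : NFATransducer (Fin 3) (Fin 3) Bool where
  δ q s := match q, s with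
    | false, some .leftEnd => {(false, none)}
    | false, some (.letter a) => {(false, if a = 0 then none else some a)}
    | false, some .rightEnd => {(true, none)}
    | _, _ => ∅
  start := false
  acc := {true}
  rej := ∅
  disjoint := by simp

theorem eraseZero_terminates : eraseZero.Terminates := by
  apply NFATransducer.terminates_of_reading
  · rintro (_ | _) <;> rfl
  · rintro (_ | _) hq (_ | _ | _) <;> simp_all [eraseZero]
  · rintro (_ | _) p o h <;> simp_all [eraseZero]

theorem eraseZero_emits (x y : List (Fin 3)) :
    eraseZero.Emits false (x.map .letter ++ [.rightEnd]) y ↔ y = x.filter (· ≠ 0) := by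
  have hf : false ∉ eraseZero.acc ∪ eraseZero.rej := by simp [eraseZero]
  have ht : true ∈ eraseZero.acc := by simp [eraseZero]
  induction x generalizing y with
  | nil =>
    rw [List.map_nil, List.nil_append, NFATransducer.emits_cons hf rfl]
    simp [eraseZero]
    simpa [eraseZero] using NFATransducer.emits_of_mem_acc ht
  | cons a x ih =>
    rw [List.map_cons, List.cons_append, NFATransducer.emits_cons hf rfl]
    have e : eraseZero.δ false (some (.letter a)) = {(false, if a = 0 then none else some a)} := rfl
    simp only [e, Set.mem_singleton_iff, Prod.mk.injEq]
    constructor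
    · rintro ⟨p, o, z, ⟨rfl, rfl⟩, h, rfl⟩
      rw [(ih z).1 h]
      by_cases ha : a = 0 <;> simp [ha]
    · rintro rfl
      refine ⟨_, _, _, ⟨rfl, rfl⟩, (ih _).2 rfl, ?_⟩
      by_cases ha : a = 0 <;> simp [ha]

theorem eraseZero_function (x : List (Fin 3)) :
    eraseZero.function x = {x.filter (· ≠ 0)} := by
  ext y
  have hf : false ∉ eraseZero.acc ∪ eraseZero.rej := by simp [eraseZero]
  have e : eraseZero.δ false (some .leftEnd) = {(false, none)} := rfl
  have e' : eraseZero.start = false := rfl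
  rw [NFATransducer.mem_function_iff, inputTape, e', NFATransducer.emits_cons hf rfl, e]
  simp [eraseZero_emits]

/-- The shifted letter that is expected below a letter of `0 ^ n * 1 ^ n * 2 ^ n`. -/
def IsShiftPair (p : Option (Fin 3) × Option (Fin 3)) : Prop :=
  p = (some 0, some 1) ∨ p = (some 1, some 2) ∨ p = (some 2, none)

/-- The words in which every letter is paired with its successor after erasing the zeros. -/
def shiftLanguage : Language (Fin 3) :=
  {x | ∀ p ∈ track x (x.filter (· ≠ 0)), IsShiftPair p}

theorem shiftLanguage_mem_advice : shiftLanguage ∈ Advice REG NFASVt (Fin 3) := by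
  refine ⟨Fin 3, inferInstance, {w | ∀ p ∈ w, IsShiftPair p}, eraseZero.function,
    isRegular_forall_mem _, ⟨⟨⟨Bool, inferInstance, eraseZero, eraseZero_terminates, rfl⟩, ?_⟩, ?_⟩,
    fun x => ?_⟩
  · intro x
    simp [eraseZero_function]
  · intro x
    simp [eraseZero_function]
  · simp only [eraseZero_function, Set.mem_singleton_iff, exists_eq_left]
    rfl

/-- In the admitted columns a 0 above and a 1 below occur only together, and likewise a 1 above and
a 2 below. -/
theorem count_eq_of_isShiftPair {x y : List (Fin 3)} (h : ∀ p ∈ track x y, IsShiftPair p) :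
    x.count 0 = y.count 1 ∧ x.count 1 = y.count 2 := by
  induction x generalizing y with
  | nil =>
    rcases y with _ | ⟨b, y⟩
    · simp
    · simp [track, IsShiftPair] at h
  | cons a x ih =>
    rcases y with _ | ⟨b, y⟩
    · have h' := h (some a, none) (by simp [track])
      obtain ⟨h₁, h₂⟩ := ih (y := []) fun p hp => h p (by
        simp only [track, List.zipWithAll_nil, List.map_cons, List.mem_cons] at hp ⊢
        exact Or.inr hp)
      obtain rfl : a = 2 := by simpa [IsShiftPair] using h'
      simpa using ⟨h₁, h₂⟩
    · have h' := h (some a, some b) (by simp [track, List.zipWithAll])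
      obtain ⟨h₁, h₂⟩ := ih (y := y) fun p hp => h p (by
        simp only [track, List.zipWithAll, List.mem_cons] at hp ⊢
        exact Or.inr hp)
      rcases h' with h' | h' | h' <;> simp at h' <;> obtain ⟨rfl, rfl⟩ := h' <;> simp [h₁, h₂]

theorem not_isContextFree_shiftLanguage : ¬ shiftLanguage.IsContextFree := by
  apply not_isContextFree_of_count_eq
  · intro n p hp
    -- Without its zeros the word moves n places to the left, so each block lies below its
    -- predecessor and the last one is above the padding.
    have e : (threeBlocks n).filter (· ≠ 0) = List.replicate n 1 ++ List.replicate n 2 := by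
      simp [threeBlocks]
    rw [e] at hp
    obtain ⟨k, hk, rfl⟩ := mem_track.1 hp
    simp only [length_threeBlocks, List.length_append, List.length_replicate] at hk
    simp only [getElem?_threeBlocks, List.getElem?_append, List.getElem?_replicate,
      List.length_replicate, IsShiftPair]
    split_ifs <;> first | omega | simp
  · intro w hw
    obtain ⟨h₁, h₂⟩ := count_eq_of_isShiftPair hw
    rw [List.count_filter (by simp)] at h₁ h₂
    exact ⟨h₁, h₂⟩

theorem not_advice_NFASVt_contained_CFL : ¬ (Advice REG NFASVt).Contained CFL := fun h =>
  not_isContextFree_shiftLanguage (h (Fin 3) shiftLanguage_mem_advice)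

theorem not_advice_CFLSVt_contained : ¬ (Advice REG CFLSVt).Contained (CFL.inter CFL.co) := fun h =>
  not_isContextFree_shiftLanguage
    (h (Fin 3) (advice_NFASVt_contained_advice_CFLSVt (Fin 3) shiftLanguage_mem_advice)).1

/-! ### Palindromes -/

namespace ContextFreeGrammar

variable {T : Type} {g : ContextFreeGrammar T}

theorem yields_nil_iff {w : List T} : g.Yields [] w ↔ w = [] := by
  constructor
  · rintro ⟨⟩
    rfl
  · rintro rfl
    exact .nil

theorem yields_terminal_cons_iff {a : T} {s : List (Symbol T g.NT)} {w : List T} :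
    g.Yields (Symbol.terminal a :: s) w ↔ ∃ v, w = a :: v ∧ g.Yields s v := by
  constructor
  · intro h
    cases h with
    | terminal _ h => exact ⟨_, rfl, h⟩
  · rintro ⟨v, rfl, h⟩
    exact h.terminal a

theorem yields_nonterminal_cons_iff {A : g.NT} {s : List (Symbol T g.NT)} {w : List T} :
    g.Yields (Symbol.nonterminal A :: s) w ↔
      ∃ r ∈ g.rules, r.input = A ∧ ∃ u v, w = u ++ v ∧ g.Yields r.output u ∧ g.Yields s v := by
  constructor
  · intro h
    cases h with
    | nonterminal hr h₁ h₂ => exact ⟨_, hr, rfl, _, _, rfl, h₁, h₂⟩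
  · rintro ⟨r, hr, rfl, u, v, rfl, h₁, h₂⟩
    exact .nonterminal hr h₁ h₂

end ContextFreeGrammar

/-- The palindromes over a two-letter alphabet. -/
def palindromes : Language Bool := {w | w.reverse = w}

/-- The rules of a grammar for the palindromes over a two-letter alphabet. -/
def palindromeRules : Finset (ContextFreeRule Bool Unit) :=
  {⟨(), []⟩, ⟨(), [.terminal true]⟩, ⟨(), [.terminal false]⟩,
    ⟨(), [.terminal true, .nonterminal (), .terminal true]⟩,
    ⟨(), [.terminal false, .nonterminal (), .terminal false]⟩}

theorem mem_palindromeRules {r : ContextFreeRule Bool Unit} : r ∈ palindromeRules ↔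
    r.output = [] ∨ ∃ a, r.output = [.terminal a] ∨
      r.output = [.terminal a, .nonterminal (), .terminal a] := by
  rcases r with ⟨_, o⟩
  simp only [palindromeRules, Finset.mem_insert, Finset.mem_singleton, ContextFreeRule.mk.injEq,
    true_and, Bool.exists_bool]
  tauto

/-- A grammar for the palindromes over a two-letter alphabet. -/
abbrev palindromeGrammar : ContextFreeGrammar Bool where
  NT := Unit
  initial := ()
  rules := palindromeRules

open ContextFreeGrammar in
theorem palindromeGrammar_yields_iff (w : List Bool) :
    palindromeGrammar.Yields [.nonterminal ()] w ↔
      w = [] ∨ ∃ a, w = [a] ∨ ∃ v, w = a :: (v ++ [a]) ∧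
        palindromeGrammar.Yields [.nonterminal ()] v := by
  have wrap : ∀ (a : Bool) (u : List Bool),
      palindromeGrammar.Yields [.terminal a, .nonterminal (), .terminal a] u ↔
        ∃ v, u = a :: (v ++ [a]) ∧ palindromeGrammar.Yields [.nonterminal ()] v := by
    intro a u
    rw [yields_terminal_cons_iff]
    constructor
    · rintro ⟨v, rfl, hv⟩
      obtain ⟨v₁, v₂, rfl, h₁, h₂⟩ := Yields.exists_of_append
        (g := palindromeGrammar) (s := [.nonterminal ()]) (t := [.terminal a]) hv
      obtain ⟨v', rfl, h'⟩ := yields_terminal_cons_iff.1 h₂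
      obtain rfl := yields_nil_iff.1 h'
      exact ⟨v₁, rfl, h₁⟩
    · rintro ⟨v, rfl, hv⟩
      exact ⟨_, rfl, hv.append (yields_terminal [a])⟩
  constructor
  · intro h
    obtain ⟨r, hr, -, u, v, rfl, hu, hv⟩ := yields_nonterminal_cons_iff.1 h
    obtain rfl := yields_nil_iff.1 hv
    rw [List.append_nil]
    rcases mem_palindromeRules.1 hr with e | ⟨a, e | e⟩ <;> rw [e] at hu
    · exact Or.inl (yields_nil_iff.1 hu)
    · obtain ⟨v, rfl, hv⟩ := yields_terminal_cons_iff.1 hu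
      exact Or.inr ⟨a, Or.inl (by rw [yields_nil_iff.1 hv])⟩
    · exact Or.inr ⟨a, Or.inr ((wrap _ _).1 hu)⟩
  · have intro_rule : ∀ r ∈ palindromeGrammar.rules, ∀ u, palindromeGrammar.Yields r.output u →
        palindromeGrammar.Yields [.nonterminal ()] u := fun r hr u hu =>
      yields_nonterminal_cons_iff.2 ⟨r, hr, rfl, u, [], by simp, hu, .nil⟩
    rintro (rfl | ⟨a, rfl | h⟩)
    · exact intro_rule ⟨(), []⟩ (mem_palindromeRules.2 (Or.inl rfl)) _ .nil
    · exact intro_rule ⟨(), [.terminal a]⟩ (mem_palindromeRules.2 (Or.inr ⟨a, Or.inl rfl⟩)) _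
        (yields_terminal [a])
    · exact intro_rule ⟨(), [.terminal a, .nonterminal (), .terminal a]⟩
        (mem_palindromeRules.2 (Or.inr ⟨a, Or.inr rfl⟩)) _ ((wrap a _).2 h)

theorem isContextFree_palindromes : palindromes.IsContextFree := by
  refine ⟨palindromeGrammar, ?_⟩
  ext w
  rw [ContextFreeGrammar.mem_language_iff, ContextFreeGrammar.derives_iff_yields]
  constructor
  · intro h
    change w.reverse = w
    induction hn : w.length using Nat.strong_induction_on generalizing w with
    | _ n ih =>
      rcases (palindromeGrammar_yields_iff w).1 h with rfl | ⟨a, rfl | ⟨v, rfl, hv⟩⟩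
      · rfl
      · rfl
      · have := ih v.length (by rw [← hn]; simp) v hv rfl
        simp [this]
  · intro h
    have h' : w.Palindrome := List.Palindrome.of_reverse_eq h
    clear h
    induction h' with
    | nil => exact (palindromeGrammar_yields_iff _).2 (Or.inl rfl)
    | singleton a => exact (palindromeGrammar_yields_iff _).2 (Or.inr ⟨a, Or.inl rfl⟩)
    | cons_concat a _ ih =>
      exact (palindromeGrammar_yields_iff _).2 (Or.inr ⟨a, Or.inr ⟨_, rfl, ih⟩⟩)

/-- The transducer that guesses a letter of the input, then writes a blank for every later letter
and finally the guessed letter. The first component of a state tells whether it is halting. -/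
def delayLetter : NFATransducer Bool (Option Bool) (Bool × Option Bool) where
  δ q s := match q, s with
    | (false, m), some .leftEnd => {((false, m), none)}
    | (false, none), some (.letter a) => {((false, none), none), ((false, some a), none)}
    | (false, some b), some (.letter _) => {((false, some b), some none)}
    | (false, m), some .rightEnd => {((true, m), m.map some)}
    | _, _ => ∅
  start := (false, none)
  acc := {q | q.1 = true ∧ q.2 ≠ none}
  rej := {q | q.1 = true ∧ q.2 = none}
  disjoint := Set.disjoint_left.2 fun _ h h' => h.2 h'.2

theorem delayLetter_terminates : delayLetter.Terminates := by
  apply NFATransducer.terminates_of_reading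
  · rintro ⟨_ | _, _ | _⟩ <;> rfl
  · rintro ⟨_ | _, _ | _⟩ hq (_ | _ | _) <;> simp_all [delayLetter]
  · rintro ⟨_ | _, _ | _⟩ p o h <;> simp_all [delayLetter]

theorem delayLetter_emits_some (b : Bool) (x : List Bool) (y : List (Option Bool)) :
    delayLetter.Emits (false, some b) (x.map .letter ++ [.rightEnd]) y ↔
      y = List.replicate x.length none ++ [some b] := by
  have hf : (false, some b) ∉ delayLetter.acc ∪ delayLetter.rej := by simp [delayLetter]
  have ht : (true, some b) ∈ delayLetter.acc := by simp [delayLetter]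
  induction x generalizing y with
  | nil =>
    rw [List.map_nil, List.nil_append, NFATransducer.emits_cons hf rfl]
    have e : delayLetter.δ (false, some b) (some .rightEnd) = {((true, some b), some (some b))} :=
      rfl
    simp [e, NFATransducer.emits_of_mem_acc ht]
  | cons a x ih =>
    rw [List.map_cons, List.cons_append, NFATransducer.emits_cons hf rfl]
    have e : delayLetter.δ (false, some b) (some (.letter a)) = {((false, some b), some none)} :=
      rfl
    simp [e, ih, List.replicate_succ]

theorem delayLetter_emits_none (x : List Bool) (y : List (Option Bool)) :
    delayLetter.Emits (false, none) (x.map .letter ++ [.rightEnd]) y ↔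
      ∃ u b v, x = u ++ b :: v ∧ y = List.replicate v.length none ++ [some b] := by
  have hf : (false, none) ∉ delayLetter.acc ∪ delayLetter.rej := by simp [delayLetter]
  have ht : (true, none) ∈ delayLetter.rej := by simp [delayLetter]
  induction x generalizing y with
  | nil =>
    rw [List.map_nil, List.nil_append, NFATransducer.emits_cons hf rfl]
    have e : delayLetter.δ (false, none) (some .rightEnd) = {((true, none), none)} := rfl
    simp [e, NFATransducer.not_emits_of_mem_rej ht]
  | cons a x ih =>
    rw [List.map_cons, List.cons_append, NFATransducer.emits_cons hf rfl]
    have e : delayLetter.δ (false, none) (some (.letter a)) =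
      {((false, none), none), ((false, some a), none)} := rfl
    constructor
    · rintro ⟨p, o, z, hp, hz, rfl⟩
      simp only [e, Set.mem_insert_iff, Set.mem_singleton_iff, Prod.mk.injEq] at hp
      rcases hp with ⟨rfl, rfl⟩ | ⟨rfl, rfl⟩
      · obtain ⟨u, b, v, rfl, rfl⟩ := (ih z).1 hz
        exact ⟨a :: u, b, v, rfl, rfl⟩
      · exact ⟨[], a, x, rfl, (delayLetter_emits_some a x z).1 hz⟩
    · rintro ⟨_ | ⟨c, u⟩, b, v, hx, rfl⟩
      · simp only [List.nil_append, List.cons.injEq] at hx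
        obtain ⟨rfl, rfl⟩ := hx
        exact ⟨(false, some a), none, _, by simp [e], (delayLetter_emits_some a x _).2 rfl, rfl⟩
      · simp only [List.cons_append, List.cons.injEq] at hx
        obtain ⟨rfl, rfl⟩ := hx
        exact ⟨(false, none), none, _, by simp [e], (ih _).2 ⟨u, b, v, rfl, rfl⟩, rfl⟩

theorem mem_delayLetter_function {x : List Bool} {y : List (Option Bool)} :
    y ∈ delayLetter.function x ↔
      ∃ u b v, x = u ++ b :: v ∧ y = List.replicate v.length none ++ [some b] := by
  have hf : (false, none) ∉ delayLetter.acc ∪ delayLetter.rej := by simp [delayLetter]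
  have e : delayLetter.δ (false, none) (some .leftEnd) = {((false, none), none)} := rfl
  have e' : delayLetter.start = (false, none) := rfl
  rw [NFATransducer.mem_function_iff, inputTape, e', NFATransducer.emits_cons hf rfl, e]
  simp [delayLetter_emits_none]

/-- In u b v the mirror position of b has index |v|, which is where `delayLetter` writes b. The
regular language only looks for a column with two different letters. -/
theorem compl_palindromes_mem_advice : palindromesᶜ ∈ Advice REG NFAMV Bool := by
  refine ⟨Option Bool, inferInstance,
    {w | ∃ p ∈ w, ∃ a b, a ≠ b ∧ p = (some a, some (some b))}, delayLetter.function,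
    isRegular_exists_mem _, ⟨_, inferInstance, delayLetter, delayLetter_terminates, rfl⟩,
    fun x => ?_⟩
  have get : ∀ u b v, x = u ++ b :: v → x.reverse[v.length]? = some b := by
    rintro u b v rfl
    simp
  constructor
  · intro h
    have h' : x.reverse ≠ x := h
    obtain ⟨k, hk⟩ : ∃ k, x.reverse[k]? ≠ x[k]? := by
      by_contra! H
      exact h' (List.ext_getElem? H)
    have hkx : k < x.length := by
      by_contra hk'
      apply hk
      rw [List.getElem?_eq_none (by simpa using hk'), List.getElem?_eq_none (by omega)]
    have hk' : x.length - 1 - k < x.length := by omega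
    have ex : x = x.take (x.length - 1 - k) ++
        x[x.length - 1 - k] :: x.drop (x.length - 1 - k + 1) := by
      simp
    have hl : (x.drop (x.length - 1 - k + 1)).length = k := by
      simp
      omega
    refine ⟨_, mem_delayLetter_function.2 ⟨_, _, _, ex, rfl⟩, _,
      mem_track.2 ⟨k, Or.inl hkx, rfl⟩, x[k], x[x.length - 1 - k], ?_, ?_⟩
    · have := get _ _ _ ex
      rw [hl] at this
      rw [this, List.getElem?_eq_getElem hkx] at hk
      exact fun e => hk (by rw [e])
    · rw [List.getElem?_eq_getElem hkx, hl]
      simp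
  · rintro ⟨y, hy, p, hp, a, b, hab, rfl⟩ hx
    obtain ⟨u, c, v, ex, rfl⟩ := mem_delayLetter_function.1 hy
    obtain ⟨k, -, hk⟩ := mem_track.1 hp
    simp only [Prod.mk.injEq] at hk
    obtain ⟨h₁, h₂⟩ := hk
    have hr : x.reverse = x := hx
    -- Only column |v| carries a written letter: blanks stand before it and padding after it.
    rcases lt_trichotomy k v.length with hlt | rfl | hgt
    · rw [List.getElem?_append_left (by simpa using hlt)] at h₂
      simp [hlt] at h₂
    · have := get _ _ _ ex
      rw [hr, ← h₁] at this
      simp at h₂ this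
      exact hab (this.trans h₂.symm)
    · rw [List.getElem?_eq_none (by simpa using hgt)] at h₂
      simp at h₂

/-! ### A shift-reduce transducer -/

/-- The states of the shift-reduce transducer; in the state `holding n` the symbol `n` has been
popped from the stack. -/
inductive ShiftReduceState (N : Type) : Type
  | main
  | holding (n : N)
  | accepted
  | rejected

instance (N : Type) [Finite N] : Finite (ShiftReduceState N) := by
  refine Finite.of_surjective (α := Option (Option (Option N))) (fun q => match q with
    | none => .main
    | some none => .accepted
    | some (some none) => .rejected
    | some (some (some n)) => .holding n) ?_
  rintro (_ | n | _ | _)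
  exacts [⟨none, rfl⟩, ⟨some (some (some n)), rfl⟩, ⟨some none, rfl⟩, ⟨some (some none), rfl⟩]

section ShiftReduce

variable {α N : Type}

/-- The moves of the shift-reduce transducer; the bottom symbol of the stack is `none`. -/
inductive ShiftReduceMove (F : N → Language α) (K : Bool → Language α) :
    ShiftReduceState N → Option (TapeSymbol α) → Option N →
      ShiftReduceState N × List (Option N) × Option Bool → Prop
  | reject (q : ShiftReduceState N) (Z : Option N) :
      ShiftReduceMove F K q none Z (.rejected, [Z], none)
  | start (Z : Option N) : ShiftReduceMove F K .main (some .leftEnd) Z (.main, [Z], none)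
  | shift {a : α} {n : N} (Z : Option N) : [a] ∈ F n →
      ShiftReduceMove F K .main (some (.letter a)) Z (.main, [some n, Z], none)
  | pop (n : N) : ShiftReduceMove F K .main none (some n) (.holding n, [], none)
  | reduce {n₁ n₂ n : N} : F n₁ * F n₂ ≤ F n →
      ShiftReduceMove F K (.holding n₂) none (some n₁) (.main, [some n], none)
  | accept {n : N} {b : Bool} : F n ≤ K b →
      ShiftReduceMove F K (.holding n) (some .rightEnd) none (.accepted, [none], some b)
  | acceptNil {b : Bool} : [] ∈ K b →
      ShiftReduceMove F K .main (some .rightEnd) none (.accepted, [none], some b)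

/-- The transducer that parses its input bottom-up into members of the family `F` and writes `b`
when it has found the input to be in `K b`. -/
def shiftReduce [Finite N] (F : N → Language α) (K : Bool → Language α) :
    PDATransducer α Bool (ShiftReduceState N) (Option N) where
  δ q s Z := {r | ShiftReduceMove F K q s Z r}
  δ_finite q s Z := by
    refine (Set.finite_univ.prod ((List.finite_length_le (Option N) 2).prod
      Set.finite_univ)).subset ?_
    intro r hr
    refine ⟨trivial, ?_, trivial⟩
    cases hr <;> simp
  start := .main
  bottom := none
  acc := {.accepted}
  rej := {.rejected}
  disjoint := by simp

/-- The stack `st` represents a factorization of the word `u`. -/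
inductive StackParses (F : N → Language α) : List (Option N) → List α → Prop
  | bottom : StackParses F [none] []
  | push {st : List (Option N)} {u w : List α} {n : N} : StackParses F st u → w ∈ F n →
      StackParses F (some n :: st) (u ++ w)

/-- The invariant of the shift-reduce transducer on the input `x`. -/
inductive ShiftReduceInv (F : N → Language α) (K : Bool → Language α) (x : List α) :
    PDATransducer.Cfg α Bool (ShiftReduceState N) (Option N) → Prop
  | init : ShiftReduceInv F K x ⟨.main, inputTape x, [none], []⟩
  | main {u v : List α} {st : List (Option N)} : x = u ++ v → StackParses F st u →
      ShiftReduceInv F K x ⟨.main, v.map .letter ++ [.rightEnd], st, []⟩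
  | holding {u w v : List α} {st : List (Option N)} {n : N} : x = u ++ w ++ v →
      StackParses F st u → w ∈ F n →
      ShiftReduceInv F K x ⟨.holding n, v.map .letter ++ [.rightEnd], st, []⟩
  | accepted {b : Bool} {t : List (TapeSymbol α)} {st : List (Option N)} : x ∈ K b →
      ShiftReduceInv F K x ⟨.accepted, t, st, [b]⟩
  | rejected {t : List (TapeSymbol α)} {st : List (Option N)} {y : List Bool} :
      ShiftReduceInv F K x ⟨.rejected, t, st, y⟩

variable [Finite N] {F : N → Language α} {K : Bool → Language α}

/-- Soundness of the parser: from bottom to top the stack, followed by the symbol held in the state,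
always factorizes the prefix read so far. A reduction preserves this because the product of the two
members lies in the new one. -/
theorem ShiftReduceInv.step {x : List α}
    {c d : PDATransducer.Cfg α Bool (ShiftReduceState N) (Option N)}
    (hc : ShiftReduceInv F K x c) (h : (shiftReduce F K).Step c d) : ShiftReduceInv F K x d := by
  obtain ⟨hq, s, Z, w, v, o, hδ, hi, hs, hs', ho⟩ := h
  rcases d with ⟨q, t, st, y⟩
  simp only at hδ hi hs hs' ho
  change ShiftReduceMove F K _ _ _ _ at hδ
  cases hc with
  | init =>
    simp only [List.cons.injEq] at hs
    obtain ⟨rfl, rfl⟩ := hs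
    subst hs' ho
    cases hδ with
    | reject => exact .rejected
    | start =>
      simp only [inputTape, Option.toList_some, List.singleton_append, List.cons.injEq,
        true_and] at hi
      subst hi
      exact .main (u := []) rfl .bottom
    | shift _ _ => simp [inputTape] at hi
    | acceptNil _ => simp [inputTape] at hi
  | @main u v' st' hx hst =>
    subst hs' ho
    subst hs
    cases hδ with
    | reject => exact .rejected
    | start => rcases v' with _ | ⟨a, v'⟩ <;> simp at hi
    | @shift a n _ ha =>
      rcases v' with _ | ⟨a', v'⟩
      · simp at hi
      · simp only [List.map_cons, List.cons_append, Option.toList_some, List.nil_append,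
          List.cons.injEq, TapeSymbol.letter.injEq] at hi
        obtain ⟨rfl, rfl⟩ := hi
        exact .main (by simp [hx]) (.push hst ha)
    | pop n =>
      simp only [Option.toList_none, List.nil_append] at hi
      subst hi
      cases hst with
      | push hst hw => exact .holding hx hst hw
    | acceptNil hK =>
      rcases v' with _ | ⟨a', v'⟩
      · cases hst
        subst hx
        exact .accepted hK
      · simp at hi
  | @holding u w' v' st' n hx hst hw =>
    subst hs' ho
    subst hs
    cases hδ with
    | reject => exact .rejected
    | @reduce n₁ _ n hle =>
      simp only [Option.toList_none, List.nil_append] at hi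
      subst hi
      cases hst with
      | push hst hw' =>
        exact .main hx (by
          rw [List.append_assoc]
          exact .push hst (hle (Language.append_mem_mul hw' hw)))
    | accept hle =>
      rcases v' with _ | ⟨a', v'⟩
      · cases hst
        simp only [List.nil_append, List.append_nil] at hx
        subst hx
        exact .accepted (hle hw)
      · simp at hi
  | accepted _ => exact (hq (Or.inl rfl)).elim
  | rejected => exact (hq (Or.inr rfl)).elim

theorem shiftReduce_inv {x : List α} {n : ℕ}
    {c : PDATransducer.Cfg α Bool (ShiftReduceState N) (Option N)}
    (h : StepsTo (shiftReduce F K).Step n ((shiftReduce F K).init x) c) :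
    ShiftReduceInv F K x c :=
  h.invariant (fun _ _ hc hs => hc.step hs) .init

/-- The weight of a state in the bound on the length of computation paths. -/
def ShiftReduceState.weight : ShiftReduceState N → ℕ
  | .main => 1
  | .holding _ => 2
  | .accepted => 0
  | .rejected => 0

/-- In the potential a cell counts 3 and a stack symbol 2, so a shift loses one; the weights of the
states make pop and reduce lose one each. Its initial value is 3 (n + 2) + 2 + 1 = 3 n + 9. Blocked
paths can always halt through `reject`, since the stack is never empty before halting. -/
theorem shiftReduce_terminates : (shiftReduce F K).Terminates := by
  refine ⟨3, 9, fun x n c h => ⟨?_, fun hc => ?_⟩⟩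
  · have := h.add_le (fun c => 3 * c.input.length + 2 * c.stack.length + c.state.weight)
      fun c d ⟨hq, s, Z, w, v, o, hδ, hi, hs, hs', ho⟩ => by
        rcases c with ⟨q, t, st, y⟩
        rcases d with ⟨q', t', st', y'⟩
        simp only at hδ hi hs hs' ho hq ⊢
        change ShiftReduceMove F K _ _ _ _ at hδ
        subst hi hs hs'
        cases hδ with
        | reject =>
          rcases q with _ | n | _ | _
          · simp [ShiftReduceState.weight]
          · simp [ShiftReduceState.weight]
          · exact (hq (Or.inl rfl)).elim
          · exact (hq (Or.inr rfl)).elim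
        | _ => simp [ShiftReduceState.weight] <;> omega
    simp only [PDATransducer.init, length_inputTape, List.length_singleton, shiftReduce,
      ShiftReduceState.weight] at this
    omega
  · by_contra hq
    have hst : ∃ Z v, c.stack = Z :: v := by
      have parses : ∀ {st u}, StackParses F st u → ∃ Z v, st = Z :: v := by
        rintro _ _ (_ | _)
        exacts [⟨_, _, rfl⟩, ⟨_, _, rfl⟩]
      cases shiftReduce_inv h with
      | init => exact ⟨none, [], rfl⟩
      | main _ hp => exact parses hp
      | holding _ hp _ => exact parses hp
      | accepted _ => exact (hq (Or.inl rfl)).elim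
      | rejected => exact (hq (Or.inr rfl)).elim
    obtain ⟨Z, v, hv⟩ := hst
    exact hc ⟨.rejected, c.input, Z :: v, c.output⟩
      ⟨hq, none, Z, [Z], v, none, .reject _ _, rfl, hv, rfl, by simp⟩

/-- Completeness of the parser: single letters are shifted, longer words are split, parsed in two
halves and reduced. The empty word offers nothing to shift, whence `hne` and the separate move
`acceptNil`. -/
theorem shiftReduce_run (hF : IsBinaryFamily F) {n : N} {w : List α} (hw : w ∈ F n)
    (hne : w ≠ []) (t : List (TapeSymbol α)) (Z : Option N) (st : List (Option N)) :
    Relation.ReflTransGen (shiftReduce F K).Step ⟨.main, w.map .letter ++ t, Z :: st, []⟩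
      ⟨.main, t, some n :: Z :: st, []⟩ := by
  have hq : ShiftReduceState.main ∉ (shiftReduce F K).acc ∪ (shiftReduce F K).rej := by
    simp [shiftReduce]
  have hq' (n : N) :
      ShiftReduceState.holding n ∉ (shiftReduce F K).acc ∪ (shiftReduce F K).rej := by
    simp [shiftReduce]
  induction hl : w.length using Nat.strong_induction_on generalizing n w t Z st with
  | _ l ih =>
    have h₀ := List.length_pos_iff.2 hne
    rcases Nat.lt_or_ge w.length 2 with h₁ | h₂
    · obtain ⟨a, rfl⟩ := List.length_eq_one_iff.1 (show w.length = 1 by omega)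
      exact .single ⟨hq, some (.letter a), Z, [some n, Z], st, none, .shift Z hw, rfl, rfl, rfl,
        rfl⟩
    · obtain ⟨u, v, n₁, n₂, rfl, hu₀, hv₀, hu, hv, hle⟩ := hF n w hw h₂
      have hu₁ := List.length_pos_iff.2 hu₀
      have hv₁ := List.length_pos_iff.2 hv₀
      rw [List.length_append] at hl
      have r₁ := ih u.length (by omega) hu hu₀ (v.map .letter ++ t) Z st rfl
      have r₂ := ih v.length (by omega) hv hv₀ t (some n₁) (Z :: st) rfl
      rw [List.map_append, List.append_assoc]
      refine ((r₁.trans r₂).tail (b := ⟨.main, t, some n₂ :: some n₁ :: Z :: st, []⟩)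
        (c := ⟨.holding n₂, t, some n₁ :: Z :: st, []⟩) ?_).tail ?_
      · exact ⟨hq, none, some n₂, [], some n₁ :: Z :: st, none, .pop n₂, rfl, rfl, rfl, rfl⟩
      · exact ⟨hq' n₂, none, some n₁, [some n], Z :: st, none, .reduce hle, rfl, rfl, rfl, rfl⟩

theorem mem_shiftReduce_function (hF : IsBinaryFamily F) (hK : ∀ b, ∃ n, F n = K b)
    {x : List α} {y : List Bool} :
    y ∈ (shiftReduce F K).function x ↔ ∃ b, x ∈ K b ∧ y = [b] := by
  constructor
  · rintro ⟨n, c, h, ha, rfl⟩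
    cases shiftReduce_inv h with
    | accepted hx => exact ⟨_, hx, rfl⟩
    | _ => simp [shiftReduce] at ha
  · rintro ⟨b, hx, rfl⟩
    have hq : ShiftReduceState.main ∉ (shiftReduce F K).acc ∪ (shiftReduce F K).rej := by
      simp [shiftReduce]
    have hq' (n : N) :
        ShiftReduceState.holding n ∉ (shiftReduce F K).acc ∪ (shiftReduce F K).rej := by
      simp [shiftReduce]
    have r₀ : (shiftReduce F K).Step ((shiftReduce F K).init x)
        ⟨.main, x.map .letter ++ [.rightEnd], [none], []⟩ :=
      ⟨hq, some .leftEnd, none, [none], [], none, .start _, rfl, rfl, rfl, rfl⟩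
    suffices H : Relation.ReflTransGen (shiftReduce F K).Step
        ⟨.main, x.map .letter ++ [.rightEnd], [none], []⟩ ⟨.accepted, [], [none], [b]⟩ by
      obtain ⟨n, hn⟩ := exists_stepsTo_iff.2 (H.head r₀)
      exact ⟨n, _, hn, rfl, rfl⟩
    rcases eq_or_ne x [] with rfl | hne
    · exact .single ⟨hq, some .rightEnd, none, [none], [], some b, .acceptNil hx, rfl, rfl, rfl,
        rfl⟩
    · obtain ⟨n, hn⟩ := hK b
      refine ((shiftReduce_run hF (hn ▸ hx : x ∈ F n) hne [.rightEnd] none []).tail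
        (c := ⟨.holding n, [.rightEnd], [none], []⟩) ?_).tail ?_
      · exact ⟨hq, none, some n, [], [none], none, .pop n, rfl, rfl, rfl, rfl⟩
      · exact ⟨hq' n, some .rightEnd, none, [none], [], some b, .accept hn.le, rfl, rfl, rfl, rfl⟩

end ShiftReduce

/-- One transducer parses with respect to both `L` and `Lᶜ`. Exactly one bit can be written, so its
function is single-valued and total, and the regular language reads this bit. -/
theorem inter_co_contained_advice_CFLSVt : (CFL.inter CFL.co).Contained (Advice REG CFLSVt) := by
  rintro α _ L ⟨hL, hL'⟩
  obtain ⟨N, _, F, s, hs, hF⟩ := Language.IsContextFree.exists_isBinaryFamily hL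
  obtain ⟨N', _, F', s', hs', hF'⟩ := Language.IsContextFree.exists_isBinaryFamily hL'
  let K : Bool → Language α := fun b => if b then L else Lᶜ
  have hK : ∀ b, ∃ n, Sum.elim F F' n = K b := by
    rintro (_ | _)
    · exact ⟨.inr s', by simpa [K] using hs'⟩
    · exact ⟨.inl s, by simpa [K] using hs⟩
  have hfun := fun x y => mem_shiftReduce_function (x := x) (y := y) (hF.sumElim hF') hK
  have hmem : ∀ x b, x ∈ K b ↔ (b = true ↔ x ∈ L) := by
    rintro x (_ | _)
    · change x ∉ L ↔ _
      simp
    · simp [K]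
  refine ⟨Bool, inferInstance, {w | ∃ p ∈ w, p.2 = some true}, (shiftReduce (Sum.elim F F') K).function,
    isRegular_exists_mem _, ⟨⟨⟨ShiftReduceState (N ⊕ N'), Option (N ⊕ N'), inferInstance,
      inferInstance, shiftReduce (Sum.elim F F') K,
      shiftReduce_terminates, rfl⟩, ?_⟩, ?_⟩, fun x => ?_⟩
  · intro x y hy z hz
    obtain ⟨b, hb, rfl⟩ := (hfun x y).1 hy
    obtain ⟨b', hb', rfl⟩ := (hfun x z).1 hz
    rw [hmem] at hb hb'
    rw [Bool.eq_iff_iff.2 (hb.trans hb'.symm)]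
  · intro x
    by_cases hx : x ∈ L
    · exact ⟨_, (hfun x _).2 ⟨true, (hmem _ _).2 (by simp [hx]), rfl⟩⟩
    · exact ⟨_, (hfun x _).2 ⟨false, (hmem _ _).2 (by simp [hx]), rfl⟩⟩
  · constructor
    · intro hx
      -- Column 0 exists even for empty `x`, thanks to the bit on the lower track.
      refine ⟨_, (hfun x _).2 ⟨true, (hmem _ _).2 (by simp [hx]), rfl⟩, (x[0]?, some true),
        mem_track.2 ⟨0, by simp, rfl⟩, rfl⟩
    · rintro ⟨y, hy, p, hp, hpt⟩
      obtain ⟨b, hb, rfl⟩ := (hfun x y).1 hy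
      obtain ⟨k, -, rfl⟩ := mem_track.1 hp
      have : b = true := by
        rcases k with _ | k
        · simpa using hpt
        · simp at hpt
      exact ((hmem _ _).1 hb).1 this

/-! ### Two-head systems -/

section TwoHead

variable {S τ : Type}

/-- One move of a system with two one-way heads on the tape `t`: `R` is given the symbols that are
read, `none` standing for a head that does not move. -/
def TwoHeadStep (R : S → (Bool → Option τ) → S → Prop) (t : ℕ → τ) (c d : S × (Bool → ℕ)) : Prop :=
  ∃ mv : Bool → Bool, R c.1 (fun h => if mv h then some (t (c.2 h)) else none) d.1 ∧
    ∀ h, d.2 h = c.2 h + if mv h then 1 else 0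

/-- The computations of a two-head system. -/
abbrev TwoHeadRun (R : S → (Bool → Option τ) → S → Prop) (t : ℕ → τ) :
    S × (Bool → ℕ) → S × (Bool → ℕ) → Prop :=
  Relation.ReflTransGen (TwoHeadStep R t)

variable {R : S → (Bool → Option τ) → S → Prop} {t t' t₁ t₂ : ℕ → τ} {c d : S × (Bool → ℕ)}

theorem TwoHeadStep.le (h : TwoHeadStep R t c d) (i : Bool) : c.2 i ≤ d.2 i := by
  obtain ⟨mv, -, hp⟩ := h
  rw [hp i]
  omega

theorem TwoHeadStep.le_add_one (h : TwoHeadStep R t c d) (i : Bool) : d.2 i ≤ c.2 i + 1 := by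
  obtain ⟨mv, -, hp⟩ := h
  rw [hp i]
  split_ifs <;> omega

theorem TwoHeadRun.le (h : TwoHeadRun R t c d) (i : Bool) : c.2 i ≤ d.2 i := by
  induction h with
  | refl => exact le_rfl
  | tail _ hs ih => exact ih.trans (hs.le i)

/-- A computation depends only on the tape segments that its heads read. -/
theorem TwoHeadRun.congr (h : TwoHeadRun R t c d)
    (ht : ∀ i k, c.2 i ≤ k → k < d.2 i → t k = t' k) : TwoHeadRun R t' c d := by
  induction h with
  | refl => exact .refl
  | @tail b d hb hs ih =>
    refine (ih fun i k h₁ h₂ => ht i k h₁ (h₂.trans_le (hs.le i))).tail ?_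
    obtain ⟨mv, hR, hp⟩ := hs
    refine ⟨mv, ?_, hp⟩
    convert hR using 2 with i
    split_ifs with hi
    · rw [ht i (b.2 i) (TwoHeadRun.le hb i) (by rw [hp i, if_pos hi]; omega)]
    · rfl

/-- A discrete intermediate value theorem along a computation. -/
theorem TwoHeadRun.exists_eq (h : TwoHeadRun R t c d) (f : S × (Bool → ℕ) → ℕ)
    (hf : ∀ c d, TwoHeadStep R t c d → f d ≤ f c + 1) {p : ℕ} (hc : f c ≤ p) (hd : p ≤ f d) :
    ∃ e, TwoHeadRun R t c e ∧ TwoHeadRun R t e d ∧ f e = p := by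
  induction h with
  | refl => exact ⟨c, .refl, .refl, le_antisymm hc hd⟩
  | @tail b d hb hs ih =>
    rcases le_or_gt p (f b) with hp | hp
    · obtain ⟨e, h₁, h₂, he⟩ := ih hp
      exact ⟨e, h₁, h₂.tail hs, he⟩
    · have := hf _ _ hs
      exact ⟨d, hb.tail hs, .refl, by omega⟩

/-- Both heads lie between two marks at some time of the computation `c ⟶ e ⟶ d`. -/
def CrossesTogether (R : S → (Bool → Option τ) → S → Prop) (t : ℕ → τ) (a z : ℕ)
    (c e d : S × (Bool → ℕ)) : Prop :=
  TwoHeadRun R t c e ∧ TwoHeadRun R t e d ∧ ∀ i, a ≤ e.2 i ∧ e.2 i ≤ z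

/-- The head `i` passes the marks `b` and `z` before the other head passes the mark `a`. -/
def CrossesApart (R : S → (Bool → Option τ) → S → Prop) (t : ℕ → τ) (a b z : ℕ) (i : Bool)
    (c e₁ e₂ e₃ d : S × (Bool → ℕ)) : Prop :=
  TwoHeadRun R t c e₁ ∧ TwoHeadRun R t e₁ e₂ ∧ TwoHeadRun R t e₂ e₃ ∧ TwoHeadRun R t e₃ d ∧
    e₁.2 i = b ∧ e₂.2 i = z ∧ e₂.2 (!i) < a ∧ e₃.2 (!i) = b

/-- Look at a configuration in which the leading head is at `z`. If the other head has reached `a`,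
both are between the marks. Otherwise the leading head was at `b` earlier and the other one will be
at `b` later. -/
theorem TwoHeadRun.crosses (h : TwoHeadRun R t c d) {a b z : ℕ} (hab : a ≤ b) (hbz : b ≤ z)
    (hc : ∀ i, c.2 i ≤ b) (hd : ∀ i, z ≤ d.2 i) :
    (∃ e, CrossesTogether R t a z c e d) ∨ ∃ i e₁ e₂ e₃, CrossesApart R t a b z i c e₁ e₂ e₃ d := by
  obtain ⟨e, h₁, h₂, he⟩ := h.exists_eq (fun e => max (e.2 false) (e.2 true))
    (fun c d hs => by
      have h₁ := hs.le_add_one false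
      have h₂ := hs.le_add_one true
      omega)
    (p := z) (max_le ((hc _).trans hbz) ((hc _).trans hbz)) ((hd false).trans (le_max_left _ _))
  by_cases H : ∀ i, a ≤ e.2 i
  · refine Or.inl ⟨e, h₁, h₂, fun i => ⟨H i, ?_⟩⟩
    rw [← he]
    cases i
    exacts [le_max_left _ _, le_max_right _ _]
  · push Not at H
    obtain ⟨j, hj⟩ := H
    obtain ⟨i, rfl⟩ : ∃ i, j = !i := ⟨!j, by simp⟩
    have hi : e.2 i = z := by
      cases i <;> simp only [Bool.not_true, Bool.not_false] at hj he <;> omega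
    obtain ⟨e₁, h₃, h₄, he₁⟩ := h₁.exists_eq (fun e => e.2 i) (fun c d hs => hs.le_add_one i)
      (p := b) (hc i) (hbz.trans hi.ge)
    obtain ⟨e₃, h₅, h₆, he₃⟩ := h₂.exists_eq (fun e => e.2 (!i))
      (fun c d hs => hs.le_add_one (!i)) (p := b) (hj.le.trans hab) (hbz.trans (hd _))
    exact Or.inr ⟨i, e₁, e, e₃, h₃, h₄, h₅, h₆, he₁, hi, hj, he₃⟩

/-- Before `e` only cells below `z` are read, and after `e` only cells from `a` on; so the first
half of one computation continues with the second half of the other. -/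
theorem CrossesTogether.splice {a z : ℕ} {d₁ d₂ e : S × (Bool → ℕ)}
    (h₁ : CrossesTogether R t₁ a z c e d₁) (h₂ : CrossesTogether R t₂ a z c e d₂)
    (ht₁ : ∀ k < z, t k = t₁ k) (ht₂ : ∀ k ≥ a, t k = t₂ k) : TwoHeadRun R t c d₂ :=
  (h₁.1.congr fun i k _ hk => (ht₁ k (hk.trans_le (h₁.2.2 i).2)).symm).trans
    (h₂.2.1.congr fun i k hk _ => (ht₂ k ((h₁.2.2 i).1.trans hk)).symm)

/-- The four phases are taken alternately from the computations on `t₁`, `t₂`, `t₁`, `t₂`. In the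
second phase head `i` reads between `b` and `z` while the other is before `a`; in the third the
other head reads before `b` while head `i` is beyond `z`. Outside the middle the two tapes agree. -/
theorem CrossesApart.splice {a b z : ℕ} {i : Bool} {d₁ d₂ e₁ e₂ e₃ : S × (Bool → ℕ)}
    (h₁ : CrossesApart R t₁ a b z i c e₁ e₂ e₃ d₁) (h₂ : CrossesApart R t₂ a b z i c e₁ e₂ e₃ d₂)
    (hab : a ≤ b) (hbz : b ≤ z) (ht₁ : ∀ k < b, t k = t₁ k) (ht₂ : ∀ k ≥ b, t k = t₂ k)
    (hl : ∀ k < a, t₁ k = t₂ k) (hr : ∀ k ≥ z, t₁ k = t₂ k) : TwoHeadRun R t c d₂ := by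
  obtain ⟨r₁, r₂, r₃, -, p₁, p₂, p₃, p₄⟩ := h₁
  obtain ⟨-, s₂, s₃, s₄, -, -, -, -⟩ := h₂
  have q₁ := r₂.le (!i)
  have q₂ := r₃.le i
  refine (((r₁.congr fun j k hk hk' => ?_).trans (s₂.congr fun j k hk hk' => ?_)).trans
    (r₃.congr fun j k hk hk' => ?_)).trans (s₄.congr fun j k hk hk' => ?_) <;>
    obtain rfl | rfl : j = i ∨ j = !i := by cases i <;> cases j <;> simp
  · exact (ht₁ k (by omega)).symm
  · exact (ht₁ k (by omega)).symm
  · exact (ht₂ k (by omega)).symm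
  · rw [ht₁ k (by omega), hl k (by omega)]
  · rw [ht₂ k (by omega), hr k (by omega)]
  · exact (ht₁ k (by omega)).symm
  · exact (ht₂ k (by omega)).symm
  · exact (ht₂ k (by omega)).symm

end TwoHead

/-! ### Two-head systems do not recognize the palindromes -/

/-- The input tape as an infinite sequence. -/
def tapeSeq {α : Type} (x : List α) (k : ℕ) : Option (TapeSymbol α) := (inputTape x)[k]?

theorem tapeSeq_append_left {α : Type} {p q q' : List α} {k : ℕ} (hk : k < p.length + 1) :
    tapeSeq (p ++ q) k = tapeSeq (p ++ q') k := by
  rcases k with _ | k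
  · rfl
  · simp only [tapeSeq, inputTape, List.getElem?_cons_succ, List.map_append, List.append_assoc]
    rw [List.getElem?_append_left (by simpa using hk), List.getElem?_append_left (by simpa using hk)]

theorem tapeSeq_append_right {α : Type} {p p' q : List α} {k : ℕ} (hk : p.length + 1 ≤ k)
    (hp : p.length = p'.length) : tapeSeq (p ++ q) k = tapeSeq (p' ++ q) k := by
  rcases k with _ | k
  · omega
  · simp only [tapeSeq, inputTape, List.getElem?_cons_succ, List.map_append, List.append_assoc]
    rw [List.getElem?_append_right (l₁ := p.map _) (by simp; omega),
      List.getElem?_append_right (l₁ := p'.map _) (by simp; omega)]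
    simp [hp]

/-- The starting positions of the heads: the head `false` on the left endmarker and the head `true`
on the symbol after it. -/
def startPos (h : Bool) : ℕ := if h then 1 else 0

/-- The exponent 6 counts three configurations with two head positions each. -/
theorem exists_mul_pow_lt_two_pow (D : ℕ) : ∃ m : ℕ, D * (m + 1) ^ 6 < 2 ^ m := by
  have h := isLittleO_pow_const_const_pow_of_one_lt (R := ℝ) 6 (show (1 : ℝ) < 2 by norm_num)
  have h' := (h.def (show (0 : ℝ) < 1 / (2 * D + 1) by positivity)).and
    (Filter.eventually_ge_atTop 1)
  obtain ⟨n, hn, hn₁⟩ := h'.exists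
  obtain ⟨m, rfl⟩ : ∃ m, n = m + 1 := ⟨n - 1, by omega⟩
  refine ⟨m, ?_⟩
  rw [Real.norm_of_nonneg (by positivity), Real.norm_of_nonneg (by positivity),
    one_div, inv_mul_eq_div, le_div_iff₀ (by positivity)] at hn
  have hn' : (m + 1) ^ 6 * (2 * D + 1) ≤ 2 ^ (m + 1) := by exact_mod_cast hn
  have h₁ : 0 < (m + 1) ^ 6 := by positivity
  rw [pow_succ 2 m] at hn'
  nlinarith

/-- A word with two nested pairs of blocks. -/
def nested {m : ℕ} (u : Fin m → Bool) (v v' : Fin (2 * m) → Bool) (u' : Fin m → Bool) : List Bool :=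
  List.ofFn u ++ (List.ofFn v ++ ((List.ofFn v').reverse ++ (List.ofFn u').reverse))

theorem nested_mem_palindromes {m : ℕ} {u u' : Fin m → Bool} {v v' : Fin (2 * m) → Bool} :
    nested u v v' u' ∈ palindromes ↔ u = u' ∧ v = v' := by
  change (nested u v v' u').reverse = nested u v v' u' ↔ _
  simp only [nested, List.reverse_append, List.reverse_reverse, List.append_assoc]
  constructor
  · intro h
    obtain ⟨h₁, h₂⟩ := List.append_inj h (by simp)
    obtain ⟨h₃, -⟩ := List.append_inj h₂ (by simp)
    exact ⟨(List.ofFn_injective h₁).symm, (List.ofFn_injective h₃).symm⟩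
  · rintro ⟨rfl, rfl⟩
    rfl

theorem length_nested {m : ℕ} (u u' : Fin m → Bool) (v v' : Fin (2 * m) → Bool) :
    (nested u v v' u').length = 6 * m := by
  simp [nested]
  omega

theorem not_twoHead_palindromes {S : Type} [Finite S]
    (R : S → (Bool → Option (Option (TapeSymbol Bool))) → S → Prop) (s₀ : S) (acc : Set S) (K : ℕ)
    (hcomp : ∀ x ∈ palindromes, ∃ d : S × (Bool → ℕ),
      TwoHeadRun R (tapeSeq x) (s₀, startPos) d ∧ d.1 ∈ acc ∧
        ∀ h, x.length + 1 ≤ d.2 h ∧ d.2 h ≤ K * (x.length + 1))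
    (hsound : ∀ (x : List Bool) (d : S × (Bool → ℕ)),
      TwoHeadRun R (tapeSeq x) (s₀, startPos) d → d.1 ∈ acc → (∀ h, x.length + 1 ≤ d.2 h) →
        x ∈ palindromes) : False := by
  classical
  have : Fintype S := Fintype.ofFinite S
  -- The factor 2 is for the choice of the leading head, the cube for the three configurations of
  -- `CrossesApart`.
  obtain ⟨m, hm⟩ := exists_mul_pow_lt_two_pow (2 * (Fintype.card S * (6 * K + 1) ^ 2) ^ 3)
  set X : ℕ := Fintype.card S * (K * (6 * m + 1) + 1) ^ 2 with hX
  have hXm : 2 * X ^ 3 < 2 ^ m := by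
    refine lt_of_le_of_lt ?_ hm
    have h₁ : K * (6 * m + 1) + 1 ≤ (6 * K + 1) * (m + 1) := by nlinarith
    calc 2 * X ^ 3 ≤ 2 * (Fintype.card S * ((6 * K + 1) * (m + 1)) ^ 2) ^ 3 := by
          rw [hX]; gcongr
      _ = _ := by ring
  let C : Type := S × (Bool → Fin (K * (6 * m + 1) + 1))
  have hC : Fintype.card C = X := by simp [C, hX]
  let val : C → S × (Bool → ℕ) := fun e => (e.1, fun i => (e.2 i : ℕ))
  have lift : ∀ e : S × (Bool → ℕ), (∀ i, e.2 i ≤ K * (6 * m + 1)) → ∃ e' : C, val e' = e :=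
    fun e he => ⟨(e.1, fun i => ⟨e.2 i, Nat.lt_succ_of_le (he i)⟩), rfl⟩
  let W (u : Fin m → Bool) (v : Fin (2 * m) → Bool) : ℕ → Option (TapeSymbol Bool) :=
    tapeSeq (nested u v v u)
  let Final (d : S × (Bool → ℕ)) : Prop := d.1 ∈ acc ∧ ∀ h, 6 * m + 1 ≤ d.2 h
  have main : ∀ u v,
      (∃ (e : C) (d : _), Final d ∧
        CrossesTogether R (W u v) (m + 1) (5 * m + 1) (s₀, startPos) (val e) d) ∨
      ∃ (i : Bool) (e₁ e₂ e₃ : C) (d : _), Final d ∧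
        CrossesApart R (W u v) (m + 1) (3 * m + 1) (5 * m + 1) i (s₀, startPos)
          (val e₁) (val e₂) (val e₃) d := by
    intro u v
    obtain ⟨d, hd, ha, hp⟩ := hcomp (nested u v v u) (nested_mem_palindromes.2 ⟨rfl, rfl⟩)
    simp only [length_nested] at hp
    have hle : ∀ e, TwoHeadRun R (W u v) e d → ∃ e' : C, val e' = e := fun e he =>
      lift e fun i => (he.le i).trans (hp i).2
    -- The marks are the end of u, the centre and the start of the last block, shifted by one for
    -- the left endmarker.
    rcases hd.crosses (a := m + 1) (b := 3 * m + 1) (z := 5 * m + 1) (by omega) (by omega)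
      (fun i => by cases i <;> simp [startPos]) (fun i => by have := (hp i).1; omega) with
      ⟨e, he⟩ | ⟨i, e₁, e₂, e₃, he⟩
    · obtain ⟨e, rfl⟩ := hle e he.2.1
      exact Or.inl ⟨e, d, ⟨ha, fun h => (hp h).1⟩, he⟩
    · have r₃ := he.2.2.2.1
      have r₂ := he.2.2.1.trans r₃
      have r₁ := he.2.1.trans r₂
      obtain ⟨e₁, rfl⟩ := hle e₁ r₁
      obtain ⟨e₂, rfl⟩ := hle e₂ r₂
      obtain ⟨e₃, rfl⟩ := hle e₃ r₃
      exact Or.inr ⟨i, e₁, e₂, e₃, d, ⟨ha, fun h => (hp h).1⟩, he⟩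
  by_cases H : ∃ v, ∀ u, ∃ (e : C) (d : _), Final d ∧
      CrossesTogether R (W u v) (m + 1) (5 * m + 1) (s₀, startPos) (val e) d
  · obtain ⟨v, H⟩ := H
    choose e d hd hcr using H
    have inj : Function.Injective e := by
      intro u u' huu
      have h₂ := hcr u'
      rw [← huu] at h₂
      -- The hybrid word looks like that of u below the right mark and like that of u' from the left
      -- mark on. It is accepted, hence a palindrome.
      have hrun := (hcr u).splice h₂ (t := tapeSeq (nested u v v u'))
        (fun k hk => by
          simp only [W, nested, ← List.append_assoc]
          exact tapeSeq_append_left (by simp; omega))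
        (fun k hk => tapeSeq_append_right (by simpa using hk) (by simp))
      have := hsound _ _ hrun (hd u').1 (by rw [length_nested]; exact (hd u').2)
      exact (nested_mem_palindromes.1 this).1
    have hcard := Fintype.card_le_of_injective e inj
    rw [hC] at hcard
    simp only [Fintype.card_pi, Fintype.card_bool, Finset.prod_const, Finset.card_univ,
      Fintype.card_fin] at hcard
    have := Nat.le_self_pow (show 3 ≠ 0 by norm_num) X
    omega
  · push Not at H
    have H' : ∀ v, ∃ (u : Fin m → Bool) (i : Bool) (e₁ e₂ e₃ : C) (d : _), Final d ∧
        CrossesApart R (W u v) (m + 1) (3 * m + 1) (5 * m + 1) i (s₀, startPos)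
          (val e₁) (val e₂) (val e₃) d := by
      intro v
      obtain ⟨u, hu⟩ := H v
      refine ⟨u, (main u v).resolve_left ?_⟩
      rintro ⟨e, d, hd, he⟩
      exact hu e d hd he
    choose u i e₁ e₂ e₃ d hd hcr using H'
    have inj : Function.Injective fun v => (u v, i v, e₁ v, e₂ v, e₃ v) := by
      intro v v' hvv
      simp only [Prod.mk.injEq] at hvv
      obtain ⟨q₁, q₂, q₃, q₄, q₅⟩ := hvv
      have h₂ := hcr v'
      rw [← q₁, ← q₂, ← q₃, ← q₄, ← q₅] at h₂
      -- Here the hybrid changes from v to v' at the centre, and the outer blocks are the same.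
      have hrun := (hcr v).splice h₂ (t := tapeSeq (nested (u v) v v' (u v))) (by omega) (by omega)
        (fun k hk => by
          simp only [W, nested, ← List.append_assoc (List.ofFn (u v))]
          exact tapeSeq_append_left (by simp; omega))
        (fun k hk => by
          simp only [W, nested, ← List.append_assoc (List.ofFn (u v))]
          exact tapeSeq_append_right (by simp; omega) (by simp))
        (fun k hk => tapeSeq_append_left (by simpa using hk))
        (fun k hk => by
          simp only [W, nested, ← List.append_assoc]
          exact tapeSeq_append_right (by simp; omega) (by simp))
      have := hsound _ _ hrun (hd v').1 (by rw [length_nested]; exact (hd v').2)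
      exact (nested_mem_palindromes.1 this).2
    have hcard := Fintype.card_le_of_injective _ inj
    simp only [Fintype.card_prod, hC] at hcard
    simp only [Fintype.card_pi, Fintype.card_bool, Finset.prod_const, Finset.card_univ,
      Fintype.card_fin] at hcard
    have h₁ : 2 ^ (2 * m) = 2 ^ m * 2 ^ m := by rw [two_mul, pow_add]
    have h₂ : 2 ^ m * (2 * (X * (X * X))) = 2 ^ m * (2 * X ^ 3) := by ring
    rw [h₁, h₂] at hcard
    exact absurd (Nat.le_of_mul_le_mul_left hcard (by positivity)) (by omega)

/-! ### Advice by finite transducers as a two-head system -/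

section AdviceSystem

variable {α β Q σ : Type} (M : NFATransducer α β Q) (D : DFA (Option α × Option β) σ)

/-- The letter in a cell of the input tape. -/
def cellLetter : Option (TapeSymbol α) → Option α
  | some (.letter a) => some a
  | _ => none

/-- The right endmarker and all cells beyond it act as padding below which advice may continue. -/
theorem cellLetter_tapeSeq (x : List α) (k : ℕ) : cellLetter (tapeSeq x (k + 1)) = x[k]? := by
  rw [tapeSeq, inputTape, List.getElem?_cons_succ]
  rcases lt_trichotomy k x.length with h | rfl | h
  · rw [List.getElem?_append_left (by simpa using h)]
    simp [List.getElem?_eq_getElem h, cellLetter]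
  · simp [cellLetter]
  · rw [List.getElem?_eq_none (by simpa using h), List.getElem?_eq_none (by omega)]
    rfl

/-- The moves of the two-head system in which the head `false` runs the transducer `M` and the head
`true` runs the automaton `D` on the two-track word formed with the output of `M`. -/
inductive AdviceMove : Q × σ → (Bool → Option (Option (TapeSymbol α))) → Q × σ → Prop
  | silent {q p : Q} {r : σ} {s : Option (TapeSymbol α)}
      {rd : Bool → Option (Option (TapeSymbol α))} : q ∉ M.acc ∪ M.rej → (p, none) ∈ M.δ q s →
      rd false = s.map some → rd true = none → AdviceMove (q, r) rd (p, r)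
  | write {q p : Q} {r : σ} {s e : Option (TapeSymbol α)} {z : β}
      {rd : Bool → Option (Option (TapeSymbol α))} : q ∉ M.acc ∪ M.rej → (p, some z) ∈ M.δ q s →
      rd false = s.map some → rd true = some e →
      AdviceMove (q, r) rd (p, D.step r (cellLetter e, some z))
  | rest {q : Q} {r : σ} {rd : Bool → Option (Option (TapeSymbol α))} : q ∈ M.acc →
      rd true = none → AdviceMove (q, r) rd (q, r)
  | pad {q : Q} {r : σ} {e : Option (TapeSymbol α)} {a : α}
      {rd : Bool → Option (Option (TapeSymbol α))} : q ∈ M.acc → rd true = some e →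
      cellLetter e = some a → AdviceMove (q, r) rd (q, D.step r (some a, none))

/-- The state reached by `D` on the first `j` symbols of the two-track word. -/
def trackState (x : List α) (y : List β) (j : ℕ) : σ :=
  D.eval ((List.range j).map fun k => (x[k]?, y[k]?))

theorem trackState_zero (x : List α) (y : List β) : trackState D x y 0 = D.start := rfl

theorem trackState_succ (x : List α) (y : List β) (j : ℕ) :
    trackState D x y (j + 1) = D.step (trackState D x y j) (x[j]?, y[j]?) := by
  simp [trackState, List.range_succ]

theorem trackState_append (x : List α) (y z : List β) {j : ℕ} (hj : j ≤ y.length) :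
    trackState D x (y ++ z) j = trackState D x y j := by
  unfold trackState
  congr 1
  refine List.map_congr_left fun k hk => ?_
  rw [List.getElem?_append_left ((List.mem_range.1 hk).trans_le hj)]

theorem trackState_max (x : List α) (y : List β) :
    trackState D x y (max x.length y.length) = D.eval (track x y) := by
  rw [track_eq_map_range, trackState]

variable {M D}

/-- A configuration of the system corresponds to a computation of `M` and, in an accepting state of
`M`, to some padding of its output. -/
theorem adviceMove_sound {x : List α} {d : (Q × σ) × (Bool → ℕ)}
    (h : TwoHeadRun (AdviceMove M D) (tapeSeq x) ((M.start, D.start), startPos) d) :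
    ∃ t y n j, StepsTo M.Step n (M.init x) ⟨d.1.1, t, y⟩ ∧ d.2 true = j + 1 ∧
      d.1.2 = trackState D x y j ∧ y.length ≤ j ∧ j ≤ max x.length y.length ∧
      (d.1.1 ∉ M.acc → t = (inputTape x).drop (d.2 false) ∧ j = y.length) := by
  induction h with
  | refl => exact ⟨inputTape x, [], 0, 0, .zero _, rfl, rfl, by simp, by simp, fun _ => ⟨rfl, rfl⟩⟩
  | @tail b d _ hs ih =>
    obtain ⟨t, y, n, j, hn, hp, hr, hyj, hjx, hna⟩ := ih
    obtain ⟨mv, hR, hmv⟩ := hs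
    rcases b with ⟨⟨q, r⟩, pos⟩
    rcases d with ⟨⟨q', r'⟩, pos'⟩
    simp only at hn hp hr hna hR hmv ⊢
    have hpt := hmv true
    have hpf := hmv false
    subst hr
    have tape : ∀ s : Option (TapeSymbol α),
        (if mv false = true then some (tapeSeq x (pos false)) else none) = s.map some →
        (inputTape x).drop (pos false) = s.toList ++ (inputTape x).drop (pos' false) := by
      intro s hs
      rw [hpf]
      rcases s with _ | a
      · cases hm : mv false <;> simp_all
      · cases hm : mv false
        · simp [hm] at hs
        · simp only [hm, if_true, Option.map_some, Option.some.injEq, tapeSeq] at hs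
          simpa [hs] using (List.drop_eq_getElem?_toList_append (l := inputTape x)
            (i := pos false))
    cases hR with
    | @silent _ _ _ s _ hq hδ hf ht =>
      obtain ⟨rfl, rfl⟩ := hna fun h => hq (Or.inl h)
      have hm : mv true = false := by simpa using ht
      refine ⟨_, y, n + 1, _, hn.succ (e := ⟨q', (inputTape x).drop (pos' false), y⟩)
        ⟨hq, s, none, hδ, tape s hf, by simp⟩, ?_, rfl, hyj, hjx, fun _ => ⟨rfl, rfl⟩⟩
      rw [hpt, hm, hp]
      rfl
    | @write _ _ _ s e z _ hq hδ hf ht =>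
      obtain ⟨rfl, rfl⟩ := hna fun h => hq (Or.inl h)
      have hm : mv true = true := by
        cases hm : mv true
        · simp [hm] at ht
        · rfl
      simp only [hm, if_true, Option.some.injEq] at ht hpt
      refine ⟨_, y ++ [z], n + 1, y.length + 1,
        hn.succ (e := ⟨q', (inputTape x).drop (pos' false), y ++ [z]⟩)
        ⟨hq, s, some z, hδ, tape s hf, by simp⟩, ?_, ?_, by simp, by simp, fun _ => ⟨rfl, by simp⟩⟩
      · rw [hpt, hp]
      · rw [trackState_succ, trackState_append D x y [z] le_rfl, ← ht, hp, cellLetter_tapeSeq]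
        simp
    | rest ha ht =>
      have hm : mv true = false := by simpa using ht
      exact ⟨t, y, n, j, hn, by rw [hpt, hm, hp]; rfl, rfl, hyj, hjx, fun h => (h ha).elim⟩
    | @pad _ _ e a _ ha ht he =>
      have hm : mv true = true := by
        cases hm : mv true
        · simp [hm] at ht
        · rfl
      simp only [hm, if_true, Option.some.injEq] at ht hpt
      rw [← ht, hp, cellLetter_tapeSeq] at he
      obtain ⟨hjl, -⟩ := List.getElem?_eq_some_iff.1 he
      by_cases hjy : j < y.length
      · omega
      refine ⟨t, y, n, j + 1, hn, by rw [hpt, hp], ?_, by omega, by omega, fun h => (h ha).elim⟩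
      rw [trackState_succ, he, List.getElem?_eq_none (by omega)]

/-- Head positions. -/
def headPos (i j : ℕ) (h : Bool) : ℕ := if h then j else i

/-- The head `true` advances once per written symbol, so it always stands on the letter for the next
column. -/
theorem adviceMove_of_stepsTo {x : List α} {n : ℕ} {c : NFATransducer.Cfg α β Q}
    (h : StepsTo M.Step n (M.init x) c) :
    ∃ i, TwoHeadRun (AdviceMove M D) (tapeSeq x) ((M.start, D.start), startPos)
        ((c.state, trackState D x c.output c.output.length), headPos i (c.output.length + 1)) ∧
      c.input = (inputTape x).drop i ∧ i ≤ x.length + 2 ∧ c.output.length ≤ n := by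
  generalize e : M.init x = c₀ at h
  induction h with
  | zero =>
    subst e
    refine ⟨0, ?_, rfl, by omega, le_rfl⟩
    have : headPos 0 1 = startPos := rfl
    simp only [NFATransducer.init, List.length_nil, trackState_zero, this]
    exact .refl
  | @succ n _ c d _ hs ih =>
    obtain ⟨i, hrun, hin, hi, hl⟩ := ih e
    obtain ⟨hq, s, o, hδ, hci, ho⟩ := hs
    have hmove : ∃ mv : Bool, (if mv = true then some (tapeSeq x i) else none) = s.map some ∧
        d.input = (inputTape x).drop (i + if mv = true then 1 else 0) ∧
        i + (if mv = true then 1 else 0) ≤ x.length + 2 := by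
      rcases s with _ | a
      · exact ⟨false, rfl, by simpa [hin] using hci.symm, hi⟩
      · have hd : (inputTape x).drop i = a :: d.input := by rw [← hin, hci]; rfl
        have hlt : i < (inputTape x).length := by
          by_contra hge
          rw [List.drop_eq_nil_of_le (by omega)] at hd
          simp at hd
        rw [List.drop_eq_getElem_cons hlt] at hd
        simp only [List.cons.injEq] at hd
        refine ⟨true, ?_, hd.2.symm, ?_⟩
        · simp [tapeSeq, List.getElem?_eq_getElem hlt, hd.1]
        · rw [length_inputTape] at hlt
          simp only [if_true]
          omega
    obtain ⟨mv, hmv, hdi, hle⟩ := hmove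
    refine ⟨_, hrun.tail ?_, hdi, hle, ?_⟩
    · rcases o with _ | z
      · simp only [Option.toList_none, List.append_nil] at ho
        rw [ho]
        refine ⟨fun h => if h then false else mv, .silent hq hδ (by simpa [headPos] using hmv) rfl,
          ?_⟩
        rintro (_ | _) <;> simp [headPos]
      · simp only [Option.toList_some] at ho
        rw [ho, List.length_append, List.length_singleton, trackState_succ,
          trackState_append D x _ _ le_rfl, ← cellLetter_tapeSeq]
        have hz : (c.output ++ [z])[c.output.length]? = some z := by simp
        rw [hz]
        refine ⟨fun h => if h then true else mv, .write hq hδ (by simpa [headPos] using hmv) rfl, ?_⟩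
        rintro (_ | _) <;> simp [headPos]
    · rw [ho, List.length_append]
      have : o.toList.length ≤ 1 := by cases o <;> simp
      omega

/-- When the output is shorter than the input, `D` still has to read the remaining letters above the
padding. -/
theorem adviceMove_pad {x : List α} {y : List β} {q : Q} (hq : q ∈ M.acc) (i : ℕ) {j : ℕ}
    (hyj : y.length ≤ j) (hj : j ≤ max x.length y.length) :
    TwoHeadRun (AdviceMove M D) (tapeSeq x)
      ((q, trackState D x y y.length), headPos i (y.length + 1))
      ((q, trackState D x y j), headPos i (j + 1)) := by
  induction j, hyj using Nat.le_induction with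
  | base => exact .refl
  | succ j hyj ih =>
    have hjx : j < x.length := by omega
    refine (ih (by omega)).tail ?_
    rw [trackState_succ, List.getElem?_eq_none (by omega : y.length ≤ j),
      List.getElem?_eq_getElem hjx]
    refine ⟨fun h => h, .pad hq rfl ?_, ?_⟩
    · rw [← List.getElem?_eq_getElem hjx]
      exact cellLetter_tapeSeq x j
    · rintro (_ | _) <;> simp [headPos]

/-- A transducer may accept without reading its whole tape, whereas the crossing argument needs both
heads to traverse the word; this moves the head `false` on. -/
theorem adviceMove_rest {t : ℕ → Option (TapeSymbol α)} {q : Q} {r : σ} (hq : q ∈ M.acc) (j : ℕ)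
    {i i' : ℕ} (hi : i ≤ i') :
    TwoHeadRun (AdviceMove M D) t ((q, r), headPos i j) ((q, r), headPos i' j) := by
  induction i', hi using Nat.le_induction with
  | base => exact .refl
  | succ i' _ ih =>
    refine ih.tail ⟨fun h => !h, .rest hq rfl, ?_⟩
    rintro (_ | _) <;> simp [headPos]

end AdviceSystem

theorem palindromes_not_mem_advice : palindromes ∉ Advice REG NFAMV Bool := by
  rintro ⟨β, _, B, h, ⟨σ, _, D, rfl⟩, ⟨Q, _, M, ⟨a, b, hT⟩, rfl⟩, hL⟩
  -- Linear time bounds the output by a n + b, so both heads stay within (a + b + 2) (n + 1).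
  refine not_twoHead_palindromes (AdviceMove M D) (M.start, D.start)
    {s | s.1 ∈ M.acc ∧ s.2 ∈ D.accept} (a + b + 2) (fun x hx => ?_) (fun x d hd ha hp => ?_)
  · obtain ⟨y, ⟨n, c, hn, hc, rfl⟩, hB⟩ := (hL x).1 hx
    obtain ⟨i, hrun, -, hi, hl⟩ := adviceMove_of_stepsTo (D := D) hn
    have hna := (hT x n c hn).1
    have h₁ := adviceMove_pad (D := D) (x := x) (y := c.output) hc i (le_max_right _ _) le_rfl
    have h₂ := adviceMove_rest (D := D) (t := tapeSeq x)
      (r := trackState D x c.output (max x.length c.output.length)) hc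
      (max x.length c.output.length + 1) hi
    refine ⟨_, (hrun.trans h₁).trans h₂, ⟨hc, ?_⟩, ?_⟩
    · rw [trackState_max]
      exact hB
    · have e : (a + b + 2) * (x.length + 1) =
          a * x.length + b * x.length + 2 * x.length + a + b + 2 := by ring
      rintro (_ | _) <;> simp only [headPos, e, if_true, Bool.false_eq_true, if_false] <;>
        constructor <;> omega
  · obtain ⟨t, y, n, j, hn, hpj, hr, hyj, hjx, -⟩ := adviceMove_sound hd
    -- As the head `true` has passed all letters of `x` and `j` is at least the length of `y`, the
    -- automaton has read the full two-track word.
    have hj : j = max x.length y.length := by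
      have := hp true
      omega
    refine (hL x).2 ⟨y, ⟨n, _, hn, ha.1, rfl⟩, ?_⟩
    change D.eval (track x y) ∈ D.accept
    rw [← trackState_max, ← hj, ← hr]
    exact ha.2

theorem not_CFL_contained_advice_NFAMV : ¬ CFL.Contained (Advice REG NFAMV) := fun h =>
  palindromes_not_mem_advice (h Bool isContextFree_palindromes)

theorem not_closedUnderCompl_advice_NFAMV : ¬ (Advice REG NFAMV).ClosedUnderCompl := fun h =>
  palindromes_not_mem_advice (compl_compl palindromes ▸ h Bool _ compl_palindromes_mem_advice)

theorem mainTheorem6 :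
    (¬ (Advice REG NFASVt).Contained CFL ∧ ¬ CFL.Contained (Advice REG NFAMV)) ∧
    ((Advice REG NFASVt).ClosedUnderCompl ∧ ¬ (Advice REG NFAMV).ClosedUnderCompl) ∧
    (CFL.inter CFL.co).ProperlyContained (Advice REG CFLSVt) := by
  exact ⟨⟨not_advice_NFASVt_contained_CFL, not_CFL_contained_advice_NFAMV⟩,
    ⟨closedUnderCompl_advice_NFASVt, not_closedUnderCompl_advice_NFAMV⟩,
    inter_co_contained_advice_CFLSVt, not_advice_CFLSVt_contained⟩
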